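/- Let $G$ be a finite simple connected planar graph with minimum degree $\delta(G)\ge 3$ and girth $g(G)\ge 4$ (that is, $G$ has no triangle). Then $b_i(G)\le 6$. Here an independent dominating set of a graph $H$ is a set of pairwise non-adjacent vertices of $H$ such that every vertex outside the set has a neighbour in it; $\gamma_i(H)$ is the minimum cardinality of an independent dominating set of $H$; and the independent bondage number $b_i(G)$ is the minimum cardinality of an edge set $B\subseteq E(G)$ with $\gamma_i(G-B)>\gamma_i(G)$. In particular, the theorem asserts that there is a set of at most six edges whose deletion from $G$ increases $\gamma_i$. -/

import Mathlib

namespace SimpleGraph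

/-! ### Independent domination and independent bondage -/

/-- `S` is an independent dominating set of `G`: no two vertices of `S` are adjacent, and every
vertex outside `S` has a neighbour in `S`. -/
def IsIndependentDominatingSet {V : Type*} (G : SimpleGraph V) (S : Set V) : Prop :=
  G.IsIndepSet S ∧ ∀ v, v ∉ S → ∃ u ∈ S, G.Adj u v

/-- The independent domination number `γ_i(G)`: the least cardinality of an independent dominating
set (for finite graphs such sets exist, see `exists_isIndependentDominatingSet`). -/
noncomputable def independentDominationNumber {V : Type*} (G : SimpleGraph V) : ℕ :=
  sInf {k : ℕ | ∃ S : Finset V, G.IsIndependentDominatingSet (S : Set V) ∧ S.card = k}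

/-- The infimum defining the independent domination number of a finite graph is a minimum over a
nonempty set. -/
theorem exists_isIndependentDominatingSet {V : Type*} [Finite V] (G : SimpleGraph V) :
    ∃ S : Finset V, G.IsIndependentDominatingSet (S : Set V) := by
  classical
  have hne : {S : Finset V | G.IsIndepSet (S : Set V)}.Nonempty := ⟨∅, by simp⟩
  obtain ⟨S, hS⟩ := (Set.toFinite {S : Finset V | G.IsIndepSet (S : Set V)}).exists_maximal hne
  refine ⟨S, hS.prop, fun v hv => ?_⟩
  by_contra! h
  have hins : G.IsIndepSet ((insert v S : Finset V) : Set V) := by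
    rw [Finset.coe_insert, isIndepSet_iff]
    exact Set.pairwise_insert.2 ⟨hS.prop, fun u hu _ =>
      ⟨fun hvu => h u hu hvu.symm, h u hu⟩⟩
  exact hv (hS.le_of_ge hins (Finset.subset_insert v S) (Finset.mem_insert_self v S))

/-- The independent bondage number `b_i(G)`: the least size of a set `B` of edges of `G` with
`γ_i(G - B) > γ_i(G)`. It takes values in `ℕ∞`, being `⊤` exactly when no such `B` exists. -/
noncomputable def independentBondageNumber {V : Type*} (G : SimpleGraph V) : ℕ∞ :=
  ⨅ (B : Finset (Sym2 V)) (_ : (B : Set (Sym2 V)) ⊆ G.edgeSet ∧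
    G.independentDominationNumber <
      (G.deleteEdges (B : Set (Sym2 V))).independentDominationNumber), (B.card : ℕ∞)

/-! ### Planarity of finite graphs, through embeddings in the sphere given as combinatorial maps -/

/-- A rotation system on `G`: a permutation of the darts (oriented edges) of `G` whose cycles are
the sets of darts leaving a common vertex. It is the cyclic order of the edge ends around each
vertex, and thus a cellular embedding of each component of `G` in a closed oriented surface. -/
structure RotationSystem {V : Type*} (G : SimpleGraph V) where
  /-- the next dart in the cyclic order around the source of a dart -/
  next : Equiv.Perm G.Dart
  sameCycle_iff : ∀ d d' : G.Dart, next.SameCycle d d' ↔ d.fst = d'.fst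

namespace RotationSystem

/-- Walking along face boundaries: having arrived along the dart `d`, continue with the dart that
follows the reverse of `d` in the cyclic order around the end of `d`. -/
def facePerm {V : Type*} {G : SimpleGraph V} (R : RotationSystem G) : Equiv.Perm G.Dart :=
  (Function.Involutive.toPerm Dart.symm Dart.symm_involutive).trans R.next

/-- The boundary walks of faces: the cycles of the face permutation. -/
def Face {V : Type*} {G : SimpleGraph V} (R : RotationSystem G) : Type _ :=
  Quotient (Equiv.Perm.SameCycle.setoid R.facePerm)

/-- The total number of faces of the embeddings of the components of `G`. A component that is an
isolated vertex sits on a sphere with one face, which has no dart on its boundary. -/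
noncomputable def numFaces {V : Type*} {G : SimpleGraph V} (R : RotationSystem G) : ℕ :=
  Nat.card R.Face + Nat.card {v : V // ∀ w, ¬ G.Adj v w}

/-- Every component is embedded in a sphere. Each component has Euler characteristic
`V - E + F = 2 - 2 g` with `g ≥ 0` the genus of its surface, so all genera vanish if and only if
the sum over the components is twice their number. -/
def IsSpherical {V : Type*} {G : SimpleGraph V} (R : RotationSystem G) : Prop :=
  Nat.card V + R.numFaces = Nat.card G.edgeSet + 2 * Nat.card G.ConnectedComponent

end RotationSystem

/-- A finite graph is planar if it can be embedded in the plane, equivalently in the sphere: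
it has a rotation system of genus zero. -/
def IsPlanar {V : Type*} (G : SimpleGraph V) : Prop :=
  ∃ R : RotationSystem G, R.IsSpherical

end SimpleGraph

/-! ### Exchange arguments in minimum independent dominating sets -/

namespace SimpleGraph

variable {V : Type*} {G : SimpleGraph V}

/-! Suppose that deleting six edges never increases `γ_i`. If at most six edges meet `{u, v}`,
delete them all: a minimum independent dominating set `D` of the remaining graph contains the
isolated vertices `u` and `v`, has at most `γ_i(G)` elements, and dominates everything outside `D`
without using `u` or `v`. For adjacent `u`, `v` this is absurd, so adjacent degrees sum to at least
8 (`lt_degree_add_degree_of_adj`); in particular a neighbour of a 3-vertex has degree at least 5.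
For non-adjacent 3-vertices, `D` is a minimum independent dominating set of `G` itself, with `u` and
`v` redundant as dominators (`exists_isRedundantPair`). Such a `D` is so wasteful that local
exchanges (`IsMinIDS.card_le_of_swap`) often make it smaller, which forbids certain quadrangulated
neighbourhoods of 5-vertices (`IsRedundantPair.false_of_chain`,
`IsRedundantPair.false_of_adjacent_stars`).

These prohibitions feed a discharging argument. Give a vertex the charge `deg - 4` and a face the
charge `length - 4`; by Euler's formula the total is `-8`, and no face is negative because there are
no triangles. Every 3-vertex takes 1/3 from each neighbour. A 5-vertex with at least four
3-neighbours is poor and takes 1/3 at each corner lying in a face of length at least 5. If it has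
exactly four 3-neighbours and no such corner it is needy, and takes 1/3 from its remaining
neighbour.

A 5-vertex with five 3-neighbours has two long corners (`false_of_four_corners`). A needy vertex has
no neighbour of degree 4. Beside a needy neighbour of a 5-vertex, both adjacent positions in the
rotation hold vertices that receive nothing. Faces can pay, because no three consecutive vertices of
a face are poor. So all final charges are nonnegative, contradicting the total `-8`. -/

theorem independentDominationNumber_le {S : Finset V}
    (h : G.IsIndependentDominatingSet (S : Set V)) : G.independentDominationNumber ≤ S.card :=
  Nat.sInf_le ⟨S, h, rfl⟩

theorem exists_card_eq_independentDominationNumber [Finite V] (G : SimpleGraph V) :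
    ∃ S : Finset V, G.IsIndependentDominatingSet (S : Set V) ∧
      S.card = G.independentDominationNumber := by
  obtain ⟨S, hS⟩ := exists_isIndependentDominatingSet G
  exact Nat.sInf_mem
    (s := {k : ℕ | ∃ S : Finset V, G.IsIndependentDominatingSet (S : Set V) ∧ S.card = k})
    ⟨_, S, hS, rfl⟩

/-- An independent set dominating everything outside `Y` extends to an independent dominating set
by vertices of `Y`. -/
theorem independentDominationNumber_le_card_add_card [Finite V] {I Y : Finset V}
    (hI : ∀ a ∈ I, ∀ b ∈ I, ¬ G.Adj a b)
    (h : ∀ v, v ∈ Y ∨ v ∈ I ∨ ∃ u ∈ I, G.Adj u v) :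
    G.independentDominationNumber ≤ I.card + Y.card := by
  classical
  let P : Set (Finset V) := {S | I ⊆ S ∧ ∀ a ∈ S, ∀ b ∈ S, ¬ G.Adj a b}
  obtain ⟨S, hS⟩ := (Set.toFinite P).exists_maximal ⟨I, subset_rfl, hI⟩
  obtain ⟨hIS, hind⟩ := hS.prop
  have hids : G.IsIndependentDominatingSet (S : Set V) := by
    refine ⟨fun a ha b hb _ => hind a ha b hb, fun v hv => ?_⟩
    by_contra! hno
    have hmem : insert v S ∈ P := by
      refine ⟨hIS.trans (Finset.subset_insert v S), fun a ha b hb hab => ?_⟩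
      rcases Finset.mem_insert.1 ha with ha' | ha' <;>
        rcases Finset.mem_insert.1 hb with hb' | hb'
      · exact hab.ne (ha'.trans hb'.symm)
      · exact hno b hb' (ha' ▸ hab.symm)
      · exact hno a ha' (hb' ▸ hab)
      · exact hind a ha' b hb' hab
    exact hv (hS.le_of_ge hmem (Finset.subset_insert v S) (Finset.mem_insert_self v S))
  have hsub : S ⊆ I ∪ Y := by
    intro v hv
    rcases h v with h | h | ⟨u, hu, huv⟩
    · exact Finset.mem_union_right _ h
    · exact Finset.mem_union_left _ h
    · exact absurd huv (hind u (hIS hu) v hv)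
  exact (independentDominationNumber_le hids).trans
    ((Finset.card_le_card hsub).trans (Finset.card_union_le _ _))

/-- `D` is an independent dominating set of minimum size. -/
structure IsMinIDS (G : SimpleGraph V) (D : Finset V) : Prop where
  indep : ∀ a ∈ D, ∀ b ∈ D, ¬ G.Adj a b
  dom : ∀ v, v ∉ D → ∃ u ∈ D, G.Adj u v
  card_le : D.card ≤ G.independentDominationNumber

/-- Exchanging a part `R` of a minimum independent dominating set for `C`, and repairing the
domination inside `Y`, does not save anything. -/
theorem IsMinIDS.card_le_of_swap [Finite V] {D : Finset V} (hD : G.IsMinIDS D) {R C Y : Finset V}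
    (hR : ∀ r ∈ R, r ∈ D) (hC : ∀ a ∈ C, ∀ b ∈ C, ¬ G.Adj a b)
    (hCD : ∀ c ∈ C, ∀ d ∈ D, G.Adj c d → d ∈ R)
    (hRC : ∀ r ∈ R, ∃ c ∈ C, G.Adj c r)
    (hN : ∀ r ∈ R, ∀ v, G.Adj r v →
      v ∈ C ∨ v ∈ Y ∨ (∃ c ∈ C, G.Adj c v) ∨ ∃ d ∈ D, d ∉ R ∧ G.Adj d v) :
    R.card ≤ C.card + Y.card := by
  classical
  have key := independentDominationNumber_le_card_add_card (G := G) (I := (D \ R) ∪ C) (Y := Y)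
    (by
      intro a ha b hb hab
      simp only [Finset.mem_union, Finset.mem_sdiff] at ha hb
      rcases ha with ⟨ha, haR⟩ | ha <;> rcases hb with ⟨hb, hbR⟩ | hb
      · exact hD.indep a ha b hb hab
      · exact haR (hCD b hb a ha hab.symm)
      · exact hbR (hCD a ha b hb hab)
      · exact hC a ha b hb hab)
    (by
      intro v
      simp only [Finset.mem_union, Finset.mem_sdiff]
      by_cases hv : v ∈ D
      · by_cases hvR : v ∈ R
        · obtain ⟨c, hc, hcv⟩ := hRC v hvR
          exact Or.inr (Or.inr ⟨c, Or.inr hc, hcv⟩)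
        · exact Or.inr (Or.inl (Or.inl ⟨hv, hvR⟩))
      · obtain ⟨d, hd, hdv⟩ := hD.dom v hv
        by_cases hdR : d ∈ R
        · rcases hN d hdR v hdv with h | h | ⟨c, hc, h⟩ | ⟨d', hd', h1, h2⟩
          · exact Or.inr (Or.inl (Or.inr h))
          · exact Or.inl h
          · exact Or.inr (Or.inr ⟨c, Or.inr hc, h⟩)
          · exact Or.inr (Or.inr ⟨d', Or.inl ⟨hd', h1⟩, h2⟩)
        · exact Or.inr (Or.inr ⟨d, Or.inl ⟨hd, hdR⟩, hdv⟩))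
  have h1 := Finset.card_union_le (D \ R) C
  have h2 : (D \ R).card + R.card = D.card :=
    Finset.card_sdiff_add_card_eq_card (fun r hr => hR r hr)
  have h3 := hD.card_le
  omega

theorem le_independentDominationNumber_of_lt_bondage [Finite V]
    {k : ℕ} (hb : (k : ℕ∞) < G.independentBondageNumber) {B : Finset (Sym2 V)}
    (hB : (B : Set (Sym2 V)) ⊆ G.edgeSet) (hcard : B.card ≤ k) :
    (G.deleteEdges (B : Set (Sym2 V))).independentDominationNumber
      ≤ G.independentDominationNumber := by
  by_contra! hlt
  refine absurd hb (not_lt.2 ?_)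
  refine (iInf₂_le B ⟨hB, hlt⟩).trans ?_
  exact_mod_cast hcard

/-- Isolating two vertices does not increase the independent domination number, so there is a small
set containing both that dominates the rest without their help. -/
theorem exists_finset_of_lt_bondage [Fintype V] [DecidableEq V] [DecidableRel G.Adj]
    {k : ℕ} (hb : (k : ℕ∞) < G.independentBondageNumber) (u v : V)
    (hcard : (G.incidenceFinset u ∪ G.incidenceFinset v).card ≤ k) :
    ∃ D : Finset V, u ∈ D ∧ v ∈ D ∧ D.card ≤ G.independentDominationNumber ∧
      (∀ a ∈ D, ∀ b ∈ D, a ≠ u → a ≠ v → b ≠ u → b ≠ v → ¬ G.Adj a b) ∧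
      ∀ a, a ∉ D → ∃ d ∈ D, d ≠ u ∧ d ≠ v ∧ G.Adj d a := by
  set B := G.incidenceFinset u ∪ G.incidenceFinset v with hBdef
  have hB : (B : Set (Sym2 V)) ⊆ G.edgeSet := by
    intro e he
    simp only [hBdef, Finset.coe_union, coe_incidenceFinset, Set.mem_union] at he
    rcases he with he | he
    · exact he.1
    · exact he.1
  have hle := le_independentDominationNumber_of_lt_bondage hb hB hcard
  obtain ⟨D, hD, hDc⟩ :=
    exists_card_eq_independentDominationNumber (G.deleteEdges (B : Set (Sym2 V)))
  have hadj : ∀ a b, (G.deleteEdges (B : Set (Sym2 V))).Adj a b ↔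
      G.Adj a b ∧ a ≠ u ∧ a ≠ v ∧ b ≠ u ∧ b ≠ v := by
    intro a b
    simp only [deleteEdges_adj, hBdef, Finset.coe_union, coe_incidenceFinset, Set.mem_union,
      mk'_mem_incidenceSet_iff]
    grind
  refine ⟨D, ?_, ?_, hDc.le.trans hle, ?_, ?_⟩
  · by_contra hu
    obtain ⟨d, -, hd⟩ := hD.2 u hu
    exact ((hadj _ _).1 hd).2.2.2.1 rfl
  · by_contra hu
    obtain ⟨d, -, hd⟩ := hD.2 v hu
    exact ((hadj _ _).1 hd).2.2.2.2 rfl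
  · intro a ha b hb h1 h2 h3 h4 hab
    exact hD.1 ha hb hab.ne ((hadj _ _).2 ⟨hab, h1, h2, h3, h4⟩)
  · intro a ha
    obtain ⟨d, hd, hda⟩ := hD.2 a ha
    obtain ⟨h, h1, h2, -, -⟩ := (hadj _ _).1 hda
    exact ⟨d, hd, h1, h2, h⟩

/-- `D` is a minimum independent dominating set containing `u` and `v`, which dominates all other
vertices without using `u` and `v`. -/
structure IsRedundantPair (G : SimpleGraph V) (D : Finset V) (u v : V) : Prop
    extends G.IsMinIDS D where
  left_mem : u ∈ D
  right_mem : v ∈ D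
  dom_ne : ∀ a, a ∉ D → ∃ d ∈ D, d ≠ u ∧ d ≠ v ∧ G.Adj d a

/-- Isolating both vertices costs exactly six edges. The resulting set is already a minimum
independent dominating set of `G`: were `u` or `v` adjacent to another of its members, dropping both
and restoring at most one would yield a smaller independent dominating set. -/
theorem exists_isRedundantPair [Fintype V] [DecidableRel G.Adj]
    (hb : 6 < G.independentBondageNumber) {u v : V} (huv : u ≠ v) (hadj : ¬ G.Adj u v)
    (hu : G.degree u = 3) (hv : G.degree v = 3) : ∃ D, G.IsRedundantPair D u v := by
  classical
  obtain ⟨D, huD, hvD, hc, hind, hdom⟩ := exists_finset_of_lt_bondage (k := 6)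
    (by exact_mod_cast hb) u v ((Finset.card_union_le _ _).trans (by simp [hu, hv]))
  have hI : ∀ a ∈ (D.erase u).erase v, ∀ b ∈ (D.erase u).erase v, ¬ G.Adj a b := by
    intro a ha b hb
    simp only [Finset.mem_erase] at ha hb
    exact hind a ha.2.2 b hb.2.2 ha.2.1 ha.1 hb.2.1 hb.1
  have hIc : ((D.erase u).erase v).card + 2 = D.card := by
    have h1 := Finset.card_erase_add_one huD
    have h2 := Finset.card_erase_add_one (s := D.erase u) (a := v)
      (Finset.mem_erase.2 ⟨huv.symm, hvD⟩)
    omega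
  -- With `z` dominated by `d`, only `z'` can be left undominated by `D` without `u` and `v`, so
  -- `γ_i ≤ |D| - 1`.
  have key : ∀ z z', (z = u ∧ z' = v ∨ z = v ∧ z' = u) → ∀ d ∈ D, d ≠ u → d ≠ v →
      ¬ G.Adj d z := by
    intro z z' hz d hd hdu hdv hdz
    have := independentDominationNumber_le_card_add_card (G := G) (Y := {z'}) hI (by
      intro a
      simp only [Finset.mem_erase, Finset.mem_singleton]
      by_cases haz : a = z'
      · exact Or.inl haz
      by_cases haz' : a = z
      · exact Or.inr (Or.inr ⟨d, ⟨hdv, hdu, hd⟩, haz' ▸ hdz⟩)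
      by_cases haD : a ∈ D
      · exact Or.inr (Or.inl (by grind))
      · obtain ⟨d', h1, h2, h3, h4⟩ := hdom a haD
        exact Or.inr (Or.inr ⟨d', ⟨h3, h2, h1⟩, h4⟩))
    simp at this
    omega
  refine ⟨D, ⟨⟨?_, fun a ha => ?_, hc⟩, huD, hvD, hdom⟩⟩
  · intro a ha b hb hab
    have := hab.symm
    by_cases h1 : a = u
    · subst h1
      by_cases h2 : b = v
      · exact hadj (h2 ▸ hab)
      · exact key a v (by simp) b hb hab.ne' h2 hab.symm
    by_cases h2 : a = v
    · subst h2
      by_cases h2 : b = u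
      · exact hadj (h2 ▸ hab.symm)
      · exact key a u (by simp) b hb h2 hab.ne' hab.symm
    by_cases h3 : b = u
    · exact key b v (by simp [h3]) a ha h1 h2 hab
    by_cases h4 : b = v
    · exact key b u (by simp [h4]) a ha h1 h2 hab
    exact hind a ha b hb h1 h2 h3 h4 hab
  · obtain ⟨d, h1, -, -, h4⟩ := hdom a ha
    exact ⟨d, h1, h4⟩

/-- The edge `uv` is counted twice in the degree sum, so a sum of at most 7 lets six deletions
isolate both ends. From the resulting `D` one of the two ends can be saved in `G`: if `u` is
dominated by the rest, at most `v` has to be restored, and otherwise `u` can be restored and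
dominates `v`. -/
theorem lt_degree_add_degree_of_adj [Fintype V] [DecidableRel G.Adj]
    (hb : 6 < G.independentBondageNumber) {u v : V} (huv : G.Adj u v) :
    7 < G.degree u + G.degree v := by
  classical
  by_contra! hlt
  have hcard : (G.incidenceFinset u ∪ G.incidenceFinset v).card ≤ 6 := by
    have h1 := Finset.card_union_add_card_inter (G.incidenceFinset u) (G.incidenceFinset v)
    have h2 : 0 < (G.incidenceFinset u ∩ G.incidenceFinset v).card := by
      refine Finset.card_pos.2 ⟨s(u, v), ?_⟩
      simp [mem_incidenceFinset, mk'_mem_incidenceSet_iff, huv]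
    simp only [card_incidenceFinset_eq_degree] at h1
    omega
  obtain ⟨D, huD, hvD, hc, hind, hdom⟩ := exists_finset_of_lt_bondage (k := 6)
    (by exact_mod_cast hb) u v hcard
  have hI : ∀ a ∈ (D.erase u).erase v, ∀ b ∈ (D.erase u).erase v, ¬ G.Adj a b := by
    intro a ha b hb
    simp only [Finset.mem_erase] at ha hb
    exact hind a ha.2.2 b hb.2.2 ha.2.1 ha.1 hb.2.1 hb.1
  have hIc : ((D.erase u).erase v).card + 2 = D.card := by
    have h1 := Finset.card_erase_add_one huD
    have h2 := Finset.card_erase_add_one (s := D.erase u) (a := v)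
      (Finset.mem_erase.2 ⟨huv.ne', hvD⟩)
    omega
  by_cases h : ∃ d ∈ (D.erase u).erase v, G.Adj d u
  · have := independentDominationNumber_le_card_add_card (G := G) (Y := {v}) hI (by
      intro a
      simp only [Finset.mem_erase, Finset.mem_singleton] at h ⊢
      by_cases haD : a ∈ D
      · grind
      · obtain ⟨d', h1, h2, h3, h4⟩ := hdom a haD
        exact Or.inr (Or.inr ⟨d', ⟨h3, h2, h1⟩, h4⟩))
    simp at this
    omega
  · push Not at h
    have := independentDominationNumber_le_card_add_card (G := G) (Y := ∅)
      (I := insert u ((D.erase u).erase v)) (by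
        intro a ha b hb hab
        rcases Finset.mem_insert.1 ha with rfl | ha <;> rcases Finset.mem_insert.1 hb with rfl | hb
        · exact hab.ne rfl
        · exact h b hb hab.symm
        · exact h a ha hab
        · exact hI a ha b hb hab) (by
      intro a
      simp only [Finset.mem_erase, Finset.mem_insert] at h ⊢
      by_cases haD : a ∈ D
      · by_cases hau : a = u
        · simp [hau]
        by_cases hav : a = v
        · exact Or.inr (Or.inr ⟨u, Or.inl rfl, hav ▸ huv⟩)
        · simp [hau, hav, haD]
      · obtain ⟨d', h1, h2, h3, h4⟩ := hdom a haD
        exact Or.inr (Or.inr ⟨d', Or.inr ⟨h3, h2, h1⟩, h4⟩))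
    have h5 := Finset.card_insert_le u ((D.erase u).erase v)
    simp at this
    omega

end SimpleGraph

/-! ### Exchanges around a 5-vertex with four consecutive 3-neighbours -/

namespace SimpleGraph

variable {V : Type*} {G : SimpleGraph V}

/-- Here `xᵢ` is the common neighbour of `uᵢ` and `uᵢ₊₁` opposite to `w`. As `u₁, u₃ ∈ D`, the
vertices `w, x₀, …, x₃` are outside `D`, which forces `u₂ ∈ D`. Trading all `D`-neighbours of `w`
for `w` then saves a vertex, since most `xᵢ` keep a dominator from outside. The coincidence excluded
by `H` is the only way out. The `xᵢ` may coincide otherwise, hence the auxiliary exchanges; `b` and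
`c` may be equal, so `v` may have degree 3. -/
theorem IsRedundantPair.false_of_chain [Finite V] {D : Finset V}
    {w u₁ u₂ u₃ u₄ v x₀ x₁ x₂ x₃ x₄ b c : V} (hD : G.IsRedundantPair D u₁ u₃)
    (hw : ∀ z, G.Adj w z ↔ z = u₁ ∨ z = u₂ ∨ z = u₃ ∨ z = u₄ ∨ z = v)
    (hu : [u₁, u₂, u₃, u₄, v].Nodup)
    (h₁ : ∀ z, G.Adj u₁ z ↔ z = w ∨ z = x₀ ∨ z = x₁) (d₁ : [w, x₀, x₁].Nodup)
    (h₂ : ∀ z, G.Adj u₂ z ↔ z = w ∨ z = x₁ ∨ z = x₂) (d₂ : [w, x₁, x₂].Nodup)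
    (h₃ : ∀ z, G.Adj u₃ z ↔ z = w ∨ z = x₂ ∨ z = x₃) (d₃ : [w, x₂, x₃].Nodup)
    (h₄ : ∀ z, G.Adj u₄ z ↔ z = w ∨ z = x₃ ∨ z = x₄) (d₄ : [w, x₃, x₄].Nodup)
    (hv : ∀ z, G.Adj v z → z = w ∨ z = x₄ ∨ z = b ∨ z = c) (hvx : G.Adj v x₄)
    (H : x₀ = x₂ → x₁ = x₃ → x₄ = x₂) : False := by
  classical
  simp only [List.nodup_cons, List.mem_cons, List.not_mem_nil, or_false, not_or, not_false_eq_true,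
    List.nodup_nil, and_true] at hu d₁ d₂ d₃ d₄
  obtain ⟨⟨u12, u13, u14, u1v⟩, ⟨u23, u24, u2v⟩, ⟨u34, u3v⟩, u4v⟩ := hu
  obtain ⟨⟨wx0, wx1⟩, x01⟩ := d₁
  obtain ⟨⟨-, wx2⟩, x12⟩ := d₂
  obtain ⟨⟨-, wx3⟩, x23⟩ := d₃
  obtain ⟨⟨-, wx4⟩, x34⟩ := d₄
  have m1 := hD.left_mem
  have m3 := hD.right_mem
  have ind := hD.indep
  have dom := hD.dom
  have dne := hD.dom_ne
  have nw : w ∉ D := fun h => ind _ m1 _ h ((h₁ w).2 (by simp))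
  have n0 : x₀ ∉ D := fun h => ind _ m1 _ h ((h₁ _).2 (by simp))
  have n1 : x₁ ∉ D := fun h => ind _ m1 _ h ((h₁ _).2 (by simp))
  have n2 : x₂ ∉ D := fun h => ind _ m3 _ h ((h₃ _).2 (by simp))
  have n3 : x₃ ∉ D := fun h => ind _ m3 _ h ((h₃ _).2 (by simp))
  have m2 : u₂ ∈ D := by
    by_contra h
    obtain ⟨d, hd, hd2⟩ := dom _ h
    rcases (h₂ d).1 hd2.symm with rfl | rfl | rfl <;> contradiction
  have e0 := dne _ n0
  have e1 := dne _ n1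
  have e2 := dne _ n2
  have e3 := dne _ n3
  clear dne
  -- Otherwise `x₁` alone replaces `u₁` and `u₂`: `w` and `x₂` are still dominated by `u₃`, and `x₀`
  -- by redundancy of the pair.
  have X1 : ∃ d ∈ D, d ≠ u₁ ∧ d ≠ u₂ ∧ G.Adj d x₁ := by
    by_contra! hX
    have hX' : ∀ d ∈ D, G.Adj x₁ d → d = u₁ ∨ d = u₂ := fun d h1 h2 => by
      by_contra! h; exact hX d h1 h.1 h.2 h2.symm
    clear ind dom
    have := hD.card_le_of_swap (R := {u₁, u₂}) (C := {x₁}) (Y := ∅) (by simp [m1, m2]) (by simp)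
      (by simpa using hX') (by simp [G.adj_comm x₁, h₁, h₂]) (by
        simp only [Finset.mem_insert, Finset.mem_singleton, Finset.notMem_empty]
        grind)
    rw [Finset.card_pair u12] at this
    simp at this
  have X2 : ∃ d ∈ D, d ≠ u₂ ∧ d ≠ u₃ ∧ G.Adj d x₂ := by
    by_contra! hX
    have hX' : ∀ d ∈ D, G.Adj x₂ d → d = u₂ ∨ d = u₃ := fun d h1 h2 => by
      by_contra! h; exact hX d h1 h.1 h.2 h2.symm
    clear ind dom
    have := hD.card_le_of_swap (R := {u₂, u₃}) (C := {x₂}) (Y := ∅) (by simp [m3, m2]) (by simp)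
      (by simpa using hX') (by simp [G.adj_comm x₂, h₃, h₂]) (by
        simp only [Finset.mem_insert, Finset.mem_singleton, Finset.notMem_empty]
        grind)
    rw [Finset.card_pair u23] at this
    simp at this
  -- If `x₀ = x₂`, this vertex sees all of `u₁, u₂, u₃` and could replace them at the price of `x₁`,
  -- with `u₄` dominating `w`.
  have X20 : u₄ ∈ D → x₀ = x₂ → ∃ d ∈ D, d ≠ u₁ ∧ d ≠ u₂ ∧ d ≠ u₃ ∧ G.Adj d x₂ := by
    intro m4 h02
    by_contra! hX
    have hX' : ∀ d ∈ D, G.Adj x₂ d → d = u₁ ∨ d = u₂ ∨ d = u₃ := fun d h1 h2 => by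
      by_contra! h; exact hX d h1 h.1 h.2.1 h.2.2 h2.symm
    have w4 : G.Adj u₄ w := (h₄ _).2 (by simp)
    clear ind dom
    have := hD.card_le_of_swap (R := {u₁, u₂, u₃}) (C := {x₂}) (Y := {x₁}) (by simp [m1, m3, m2])
      (by simp)
      (by simpa using hX') (by simp [G.adj_comm x₂, h₁, h₃, h₂, h02]) (by
        simp only [Finset.mem_insert, Finset.mem_singleton]
        grind)
    rw [Finset.card_eq_three.2 ⟨u₁, u₂, u₃, u12, u13, u23, rfl⟩] at this
    simp at this
  by_cases mv : v ∈ D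
  · have n4 : x₄ ∉ D := fun h => ind _ mv _ h hvx
    have m4 : u₄ ∈ D := by
      by_contra h
      obtain ⟨d, hd, hd2⟩ := dom _ h
      rcases (h₄ d).1 hd2.symm with rfl | rfl | rfl <;> contradiction
    have X20 := X20 m4
    clear dom
    have X3 : ∃ d ∈ D, d ≠ u₃ ∧ d ≠ u₄ ∧ G.Adj d x₃ := by
      by_contra! hX
      have hX' : ∀ d ∈ D, G.Adj x₃ d → d = u₃ ∨ d = u₄ := fun d h1 h2 => by
        by_contra! h; exact hX d h1 h.1 h.2 h2.symm
      clear ind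
      have := hD.card_le_of_swap (R := {u₃, u₄}) (C := {x₃}) (Y := ∅) (by simp [m3, m4])
        (by simp)
        (by simpa using hX') (by simp [G.adj_comm x₃, h₃, h₄]) (by
          simp only [Finset.mem_insert, Finset.mem_singleton, Finset.notMem_empty]
          grind)
      rw [Finset.card_pair u34] at this
      simp at this
    have X30 : x₀ = x₃ → ∃ d ∈ D, d ≠ u₁ ∧ d ≠ u₃ ∧ d ≠ u₄ ∧ G.Adj d x₃ := by
      intro h03
      by_contra! hX
      have hX' : ∀ d ∈ D, G.Adj x₃ d → d = u₁ ∨ d = u₃ ∨ d = u₄ := fun d h1 h2 => by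
        by_contra! h; exact hX d h1 h.1 h.2.1 h.2.2 h2.symm
      clear ind
      have := hD.card_le_of_swap (R := {u₁, u₃, u₄}) (C := {x₃}) (Y := ∅) (by simp [m1, m3, m4])
        (by simp) (by simpa using hX') (by simp [G.adj_comm x₃, h₁, h₃, h₄, h03]) (by
          have f1 : G.Adj v w := ((hw v).2 (by simp)).symm
          have f2 : G.Adj u₂ x₁ := (h₂ _).2 (by simp)
          have f3 : G.Adj u₂ x₂ := (h₂ _).2 (by simp)
          simp only [Finset.mem_insert, Finset.mem_singleton, Finset.notMem_empty]
          clear hX hX' X1 X2 X20 X3 e0 e1 e2 e3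
          simp only [forall_eq_or_imp, forall_eq]
          refine ⟨?_, ?_, ?_⟩
          · intro z hz
            rcases (h₁ z).1 hz with rfl | rfl | rfl <;> grind
          · intro z hz
            rcases (h₃ z).1 hz with rfl | rfl | rfl <;> grind
          · intro z hz
            rcases (h₄ z).1 hz with rfl | rfl | rfl <;> grind)
      simp [u13, u14, u34] at this
    have X31 : x₁ = x₃ → ∃ d ∈ D, d ≠ u₁ ∧ d ≠ u₂ ∧ d ≠ u₃ ∧ d ≠ u₄ ∧ G.Adj d x₃ := by
      intro h13
      by_contra! hX
      have hX' : ∀ d ∈ D, G.Adj x₃ d → d = u₁ ∨ d = u₂ ∨ d = u₃ ∨ d = u₄ := fun d h1 h2 => by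
        by_contra! h; exact hX d h1 h.1 h.2.1 h.2.2.1 h.2.2.2 h2.symm
      clear ind
      have := hD.card_le_of_swap (R := {u₁, u₂, u₃, u₄}) (C := {x₃}) (Y := {x₀, x₂})
        (by simp [m1, m2, m3, m4])
        (by simp) (by simpa using hX') (by simp [G.adj_comm x₃, h₁, h₂, h₃, h₄, h13]) (by
          have f1 : G.Adj v w := ((hw v).2 (by simp)).symm
          simp only [Finset.mem_insert, Finset.mem_singleton]
          clear hX hX' X1 X2 X20 X3 X30 e0 e1 e2 e3
          simp only [forall_eq_or_imp, forall_eq]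
          refine ⟨?_, ?_, ?_, ?_⟩
          · intro z hz
            rcases (h₁ z).1 hz with rfl | rfl | rfl <;> grind
          · intro z hz
            rcases (h₂ z).1 hz with rfl | rfl | rfl <;> grind
          · intro z hz
            rcases (h₃ z).1 hz with rfl | rfl | rfl <;> grind
          · intro z hz
            rcases (h₄ z).1 hz with rfl | rfl | rfl <;> grind)
      have h2 := Finset.card_le_two (a := x₀) (b := x₂)
      simp [u12, u13, u14, u23, u24, u34] at this
      omega
    have hw' : ∀ d ∈ D, G.Adj w d → d = u₁ ∨ d = u₂ ∨ d = u₃ ∨ d = u₄ ∨ d = v :=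
      fun d hd h => (hw d).1 h
    clear ind
    -- All five neighbours of `w` are in `D` and `x₀, …, x₃` have outside dominators, so the
    -- exchange would give `5 ≤ 1 + 3`.
    have := hD.card_le_of_swap (R := {u₁, u₂, u₃, u₄, v}) (C := {w}) (Y := {x₄, b, c})
      (by simp [m1, m3, m2, m4, mv]) (by simp) (by simpa using hw') (by simp [hw]) (by
        simp only [Finset.mem_insert, Finset.mem_singleton]
        clear hw'
        simp only [forall_eq_or_imp, forall_eq]
        refine ⟨?_, ?_, ?_, ?_, ?_⟩
        · intro z hz
          rcases (h₁ z).1 hz with rfl | rfl | rfl <;> grind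
        · intro z hz
          rcases (h₂ z).1 hz with rfl | rfl | rfl <;> grind
        · intro z hz
          rcases (h₃ z).1 hz with rfl | rfl | rfl <;> grind
        · intro z hz
          rcases (h₄ z).1 hz with rfl | rfl | rfl <;> grind
        · intro z hz
          rcases hv z hz with rfl | rfl | rfl | rfl <;> grind)
    have h3 := Finset.card_le_three (a := x₄) (b := b) (c := c)
    simp [u12, u13, u14, u23, u24, u34, u1v, u2v, u3v, u4v] at this
    omega
  by_cases m4 : u₄ ∈ D
  · have X20 := X20 m4
    have hw' : ∀ d ∈ D, G.Adj w d → d = u₁ ∨ d = u₂ ∨ d = u₃ ∨ d = u₄ := by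
      intro d hd h; rcases (hw d).1 h with h | h | h | h | rfl <;> simp_all
    clear ind dom
    -- Four vertices against `w` and two repairs.
    have := hD.card_le_of_swap (R := {u₁, u₂, u₃, u₄}) (C := {w}) (Y := {x₃, x₄})
      (by simp [m1, m3, m2, m4]) (by simp) (by simpa using hw') (by simp [hw]) (by
        simp only [Finset.mem_insert, Finset.mem_singleton]
        clear hw'
        simp only [forall_eq_or_imp, forall_eq]
        refine ⟨?_, ?_, ?_, ?_⟩
        · intro z hz
          rcases (h₁ z).1 hz with rfl | rfl | rfl <;> grind
        · intro z hz
          rcases (h₂ z).1 hz with rfl | rfl | rfl <;> grind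
        · intro z hz
          rcases (h₃ z).1 hz with rfl | rfl | rfl <;> grind
        · intro z hz
          rcases (h₄ z).1 hz with rfl | rfl | rfl <;> grind)
    rw [Finset.card_pair x34] at this
    simp [u12, u13, u14, u23, u24, u34] at this
  · have hw' : ∀ d ∈ D, G.Adj w d → d = u₁ ∨ d = u₂ ∨ d = u₃ := by
      intro d hd h; rcases (hw d).1 h with h | h | h | rfl | rfl <;> simp_all
    clear X20
    -- Once `x₁` or `x₂` has a dominator other than `u₁, u₂, u₃`, replacing these three by `w` needs
    -- only one repair.
    by_cases hY : ∃ d ∈ D, d ≠ u₁ ∧ d ≠ u₂ ∧ d ≠ u₃ ∧ G.Adj d x₂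
    · clear ind dom
      have := hD.card_le_of_swap (R := {u₁, u₂, u₃}) (C := {w}) (Y := {x₁})
        (by simp [m1, m3, m2]) (by simp) (by simpa using hw') (by simp [hw]) (by
          simp only [Finset.mem_insert, Finset.mem_singleton]
          clear hw'
          grind)
      simp [u12, u13, u23] at this
    by_cases hY' : ∃ d ∈ D, d ≠ u₁ ∧ d ≠ u₂ ∧ d ≠ u₃ ∧ G.Adj d x₁
    · clear ind dom
      have := hD.card_le_of_swap (R := {u₁, u₂, u₃}) (C := {w}) (Y := {x₂})
        (by simp [m1, m3, m2]) (by simp) (by simpa using hw') (by simp [hw]) (by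
          simp only [Finset.mem_insert, Finset.mem_singleton]
          clear hw'
          grind)
      simp [u12, u13, u23] at this
    obtain ⟨d, hd, hd4⟩ := dom _ m4
    have hd4' := (h₄ d).1 hd4.symm
    clear ind dom
    have h13 : x₁ = x₃ := by
      clear h₄ H
      grind
    have h02 : x₀ = x₂ := by
      clear h₄ H
      grind
    grind

end SimpleGraph

/-! ### Exchanges around two adjacent stars -/

namespace SimpleGraph

variable {V : Type*} {G : SimpleGraph V}

theorem IsMinIDS.card_le_of_exchange [Finite V] {D : Finset V} (hD : G.IsMinIDS D)
    {R C Y : Finset V} (hR : ∀ r ∈ R, r ∈ D) (hC : ∀ a ∈ C, ∀ b ∈ C, ¬ G.Adj a b)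
    (hCD : ∀ c ∈ C, ∀ d ∈ D, G.Adj c d → d ∈ R)
    (hRC : ∀ r ∈ R, ∃ c ∈ C, G.Adj c r)
    (hN : ∀ r ∈ R, ∀ v, G.Adj r v → v ∈ C ∨ v ∈ Y ∨ ∃ d ∈ D, d ∉ R ∧ G.Adj d v) :
    R.card ≤ C.card + Y.card :=
  hD.card_le_of_swap hR hC hCD hRC fun r hr v hv =>
    (hN r hr v hv).imp_right (Or.imp_right Or.inr)

set_option maxHeartbeats 4000000 in
-- The configuration is that of consecutive needy neighbours `w, w'` of a 5-vertex `y`, whose stars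
-- share the 3-vertex `s`. Membership of `p, p'` in `D` forces `q, s ∈ D`. If `y ∉ D`, replacing the
-- `D`-neighbours of `w` by `w` saves a vertex, because `p'` keeps dominating `w'`. If `y ∈ D`, then
-- `t ∈ D` too, and `w, w'` together replace six or eight vertices.
theorem IsRedundantPair.false_of_adjacent_stars [Finite V] {D : Finset V}
    {y w w' n₂ n₃ n₄ t p q s p' q' t' a f x f' x' : V} (hD : G.IsRedundantPair D p p')
    (hy : ∀ z, G.Adj y z ↔ z = w ∨ z = w' ∨ z = n₂ ∨ z = n₃ ∨ z = n₄)
    (hw : ∀ z, G.Adj w z ↔ z = y ∨ z = t ∨ z = p ∨ z = q ∨ z = s)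
    (dw : [y, t, p, q, s].Nodup)
    (hw' : ∀ z, G.Adj w' z ↔ z = y ∨ z = s ∨ z = p' ∨ z = q' ∨ z = t')
    (dw' : [y, s, p', q', t'].Nodup)
    (ht : ∀ z, G.Adj t z ↔ z = w ∨ z = n₄ ∨ z = a) (dt : [w, n₄, a].Nodup)
    (hp : ∀ z, G.Adj p z ↔ z = w ∨ z = a ∨ z = f) (dp : [w, a, f].Nodup)
    (hq : ∀ z, G.Adj q z ↔ z = w ∨ z = f ∨ z = x) (dq : [w, f, x].Nodup)
    (hs : ∀ z, G.Adj s z ↔ z = w ∨ z = x ∨ z = w') (ds : [w, x, w'].Nodup)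
    (hp' : ∀ z, G.Adj p' z ↔ z = w' ∨ z = x ∨ z = f') (dp' : [w', x, f'].Nodup)
    (hq' : ∀ z, G.Adj q' z ↔ z = w' ∨ z = f' ∨ z = x') (dq' : [w', f', x'].Nodup)
    (ht' : ∀ z, G.Adj t' z ↔ z = w' ∨ z = x' ∨ z = n₂) (dt' : [w', x', n₂].Nodup)
    (hn : n₄ ≠ w') (ha : a ≠ w') (hf : f ≠ w') : False := by
  classical
  simp only [List.nodup_cons, List.mem_cons, List.not_mem_nil, or_false, not_or, not_false_eq_true,
    List.nodup_nil, and_true] at dw dw' dt dp dq ds dp' dq' dt'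
  obtain ⟨⟨yt, yp, yq, ys⟩, ⟨tp, tq, ts⟩, ⟨pq, ps⟩, qs⟩ := dw
  obtain ⟨⟨-, yp', yq', yt'⟩, ⟨sp', sq', st'⟩, ⟨pq', pt'⟩, qt'⟩ := dw'
  obtain ⟨⟨wn4, wa⟩, n4a⟩ := dt
  obtain ⟨⟨-, wf⟩, af⟩ := dp
  obtain ⟨⟨-, wx⟩, fx⟩ := dq
  obtain ⟨⟨-, ww'⟩, xw'⟩ := ds
  obtain ⟨⟨-, w'f'⟩, xf'⟩ := dp'
  obtain ⟨⟨-, w'x'⟩, f'x'⟩ := dq'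
  obtain ⟨⟨-, w'n2⟩, x'n2⟩ := dt'
  -- The members `p', q', t'` of the second star are adjacent to `w'`, while `w'` is not among the
  -- neighbours of `t, p, q`; this is the role of `hn`, `ha`, `hf`.
  have fw : ∀ u, u = p' ∨ u = q' ∨ u = t' → u ≠ t ∧ u ≠ p ∧ u ≠ q ∧ ¬ G.Adj u w := by
    intro u hu
    have h1 : G.Adj u w' := ((hw' u).2 (by grind)).symm
    have ht1 : u ≠ t := by rintro rfl; have := (ht _).1 h1; grind
    have hp1 : u ≠ p := by rintro rfl; have := (hp _).1 h1; grind
    have hq1 : u ≠ q := by rintro rfl; have := (hq _).1 h1; grind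
    refine ⟨ht1, hp1, hq1, fun h => ?_⟩
    rcases (hw u).1 h.symm with h | h | h | h | h <;> grind
  obtain ⟨tp', pp', qp', wp'⟩ := fw p' (by simp)
  obtain ⟨tq', pq'', qq', wq'⟩ := fw q' (by simp)
  obtain ⟨tt', pt'', qt'', wt'⟩ := fw t' (by simp)
  have wf' : w ≠ f' := by rintro rfl; exact wp' ((hp' _).2 (by simp))
  have wx' : w ≠ x' := by rintro rfl; exact wq' ((hq' _).2 (by simp))
  clear fw wp' wq' wt'
  have mp := hD.left_mem
  have mp' := hD.right_mem
  have ind := hD.indep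
  have dom := hD.dom
  have dne := hD.dom_ne
  have nw : w ∉ D := fun h => ind _ mp _ h ((hp _).2 (by simp))
  have na : a ∉ D := fun h => ind _ mp _ h ((hp _).2 (by simp))
  have nf : f ∉ D := fun h => ind _ mp _ h ((hp _).2 (by simp))
  have nx : x ∉ D := fun h => ind _ mp' _ h ((hp' _).2 (by simp))
  have nw' : w' ∉ D := fun h => ind _ mp' _ h ((hp' _).2 (by simp))
  have nf' : f' ∉ D := fun h => ind _ mp' _ h ((hp' _).2 (by simp))
  have mq : q ∈ D := by
    by_contra h
    obtain ⟨d, hd, hd2⟩ := dom _ h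
    rcases (hq d).1 hd2.symm with rfl | rfl | rfl <;> contradiction
  have ms : s ∈ D := by
    by_contra h
    obtain ⟨d, hd, hd2⟩ := dom _ h
    rcases (hs d).1 hd2.symm with rfl | rfl | rfl <;> contradiction
  have ea := dne _ na
  have ef' := dne _ nf'
  have sw : G.Adj s w := (hs _).2 (by simp)
  have sx : G.Adj s x := (hs _).2 (by simp)
  have pw : G.Adj p w := (hp _).2 (by simp)
  have pf : G.Adj p f := (hp _).2 (by simp)
  have pw' : G.Adj p' w' := (hp' _).2 (by simp)
  have yw : G.Adj y w := (hy _).2 (by simp)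
  have yw' : G.Adj y w' := (hy _).2 (by simp)
  have yn4 : G.Adj y n₄ := (hy _).2 (by simp)
  clear dne
  -- Otherwise `f` replaces both `p` and `q`, with `s` dominating `w` and `x`.
  have F : ∃ d ∈ D, d ≠ p ∧ d ≠ q ∧ G.Adj d f := by
    by_contra! hX
    have hX' : ∀ d ∈ D, G.Adj f d → d = p ∨ d = q := fun d h1 h2 => by
      by_contra! h; exact hX d h1 h.1 h.2 h2.symm
    clear ind dom
    have := hD.card_le_of_exchange (R := {p, q}) (C := {f}) (Y := ∅)
      (by simp [mp, mq]) (by simp) (by simpa using hX')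
      (by
        simp only [Finset.mem_insert, Finset.mem_singleton, forall_eq_or_imp, forall_eq,
            exists_eq_left]
        exact ⟨((hp _).2 (by simp [])).symm, ((hq _).2 (by simp [])).symm⟩) (by
        simp only [Finset.mem_insert, Finset.mem_singleton, Finset.notMem_empty]
        clear ef' hX hX' hw hw'
        simp only [forall_eq_or_imp, forall_eq]
        refine ⟨?_, ?_⟩
        · intro z hz
          rcases (hp z).1 hz with rfl | rfl | rfl <;> grind
        · intro z hz
          rcases (hq z).1 hz with rfl | rfl | rfl <;> grind)
    simp [pq] at this
  -- Otherwise `x` replaces `q, s, p'`, and only `w'` may need repair.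
  have X : ∃ d ∈ D, d ≠ q ∧ d ≠ s ∧ d ≠ p' ∧ G.Adj d x := by
    by_contra! hX
    have hX' : ∀ d ∈ D, G.Adj x d → d = q ∨ d = s ∨ d = p' := fun d h1 h2 => by
      by_contra! h; exact hX d h1 h.1 h.2.1 h.2.2 h2.symm
    clear ind dom
    have := hD.card_le_of_exchange (R := {q, s, p'}) (C := {x}) (Y := {w'})
      (by simp [mq, ms, mp']) (by simp) (by simpa using hX')
      (by
        simp only [Finset.mem_insert, Finset.mem_singleton, forall_eq_or_imp, forall_eq,
            exists_eq_left]
        exact ⟨((hq _).2 (by simp [])).symm, ((hs _).2 (by simp [])).symm,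
            ((hp' _).2 (by simp [])).symm⟩) (by
        simp only [Finset.mem_insert, Finset.mem_singleton]
        clear ea F hX hX' hw hw'
        simp only [forall_eq_or_imp, forall_eq]
        refine ⟨?_, ?_, ?_⟩
        · intro z hz
          rcases (hq z).1 hz with rfl | rfl | rfl <;> grind
        · intro z hz
          rcases (hs z).1 hz with rfl | rfl | rfl <;> grind
        · intro z hz
          rcases (hp' z).1 hz with rfl | rfl | rfl <;> grind)
    simp [qs, Ne.symm qp', sp'] at this
  by_cases my : y ∈ D
  · have nn4 : n₄ ∉ D := fun h => ind _ my _ h yn4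
    have nn2 : n₂ ∉ D := fun h => ind _ my _ h ((hy _).2 (by simp))
    have mt : t ∈ D := by
      by_contra h
      obtain ⟨d, hd, hd2⟩ := dom _ h
      rcases (ht d).1 hd2.symm with rfl | rfl | rfl <;> contradiction
    have A : ∃ d ∈ D, d ≠ t ∧ d ≠ p ∧ G.Adj d a := by
      by_contra! hX
      have hX' : ∀ d ∈ D, G.Adj a d → d = t ∨ d = p := fun d h1 h2 => by
        by_contra! h; exact hX d h1 h.1 h.2 h2.symm
      clear ind dom
      have := hD.card_le_of_exchange (R := {t, p}) (C := {a}) (Y := ∅)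
        (by simp [mt, mp]) (by simp) (by simpa using hX')
        (by
          simp only [Finset.mem_insert, Finset.mem_singleton, forall_eq_or_imp, forall_eq,
              exists_eq_left]
          exact ⟨((ht _).2 (by simp [])).symm, ((hp _).2 (by simp [])).symm⟩) (by
          simp only [Finset.mem_insert, Finset.mem_singleton, Finset.notMem_empty]
          clear ef' ea X hX hX' hw hw'
          simp only [forall_eq_or_imp, forall_eq]
          refine ⟨?_, ?_⟩
          · intro z hz
            rcases (ht z).1 hz with rfl | rfl | rfl <;> grind
          · intro z hz
            rcases (hp z).1 hz with rfl | rfl | rfl <;> grind)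
      simp [tp] at this
    -- When `x = a`, the dominators supplied by `A` and `X` might still lie in the set to be
    -- removed; trading five vertices for `x` with repairs `f, f'` excludes this.
    have XA : x = a → ∃ d ∈ D, d ≠ t ∧ d ≠ p ∧ d ≠ q ∧ d ≠ s ∧ d ≠ p' ∧ G.Adj d x := by
      intro hxa
      by_contra! hX
      have hX' : ∀ d ∈ D, G.Adj x d → d = t ∨ d = p ∨ d = q ∨ d = s ∨ d = p' := fun d h1 h2 => by
        by_contra! h; exact hX d h1 h.1 h.2.1 h.2.2.1 h.2.2.2.1 h.2.2.2.2 h2.symm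
      clear ind dom
      have := hD.card_le_of_exchange (R := {t, p, q, s, p'}) (C := {x}) (Y := {f, f'})
        (by simp [mt, mp, mq, ms, mp']) (by simp) (by simpa using hX')
        (by
          simp only [Finset.mem_insert, Finset.mem_singleton, forall_eq_or_imp, forall_eq,
              exists_eq_left]
          exact ⟨((ht _).2 (by simp [hxa])).symm, ((hp _).2 (by simp [hxa])).symm,
              ((hq _).2 (by simp [hxa])).symm, ((hs _).2 (by simp [hxa])).symm,
                  ((hp' _).2 (by simp [hxa])).symm⟩) (by
          simp only [Finset.mem_insert, Finset.mem_singleton]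
          clear ef' ea F X A hX hX' hw hw'
          simp only [forall_eq_or_imp, forall_eq]
          refine ⟨?_, ?_, ?_, ?_, ?_⟩
          · intro z hz
            rcases (ht z).1 hz with rfl | rfl | rfl <;> grind
          · intro z hz
            rcases (hp z).1 hz with rfl | rfl | rfl <;> grind
          · intro z hz
            rcases (hq z).1 hz with rfl | rfl | rfl <;> grind
          · intro z hz
            rcases (hs z).1 hz with rfl | rfl | rfl <;> grind
          · intro z hz
            rcases (hp' z).1 hz with rfl | rfl | rfl <;> grind)
      have h2 := Finset.card_le_two (a := f) (b := f')
      simp [tp, tq, ts, Ne.symm tp', pq, ps, Ne.symm pp', qs, Ne.symm qp', sp'] at this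
      omega
    by_cases mt' : t' ∈ D
    · have nx' : x' ∉ D := fun h => ind _ mt' _ h ((ht' _).2 (by simp))
      have mq' : q' ∈ D := by
        by_contra h
        obtain ⟨d, hd, hd2⟩ := dom _ h
        rcases (hq' d).1 hd2.symm with rfl | rfl | rfl <;> contradiction
      have nww' : ¬ G.Adj w w' := fun h => by
        rcases (hw _).1 h with rfl | rfl | rfl | rfl | rfl <;> contradiction
      have hE : ∀ d ∈ D, G.Adj w d → d = y ∨ d = t ∨ d = p ∨ d = q ∨ d = s ∨ d = p' ∨ d = q' ∨
          d = t' := by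
        intro d hd h
        rcases (hw d).1 h with h | h | h | h | h <;> simp [h]
      have hE' : ∀ d ∈ D, G.Adj w' d → d = y ∨ d = t ∨ d = p ∨ d = q ∨ d = s ∨ d = p' ∨ d = q' ∨
          d = t' := by
        intro d hd h
        rcases (hw' d).1 h with rfl | rfl | rfl | rfl | rfl <;> first | contradiction | simp
      clear ind dom
      -- `P` collects the vertices that need no further care after the exchange: those inserted,
      -- those allowed as repairs, and those with a dominator that is kept. Packing it into an
      -- opaque predicate keeps the case analysis small.
      obtain ⟨P, hP⟩ : ∃ P : V → Prop, ∀ z, P z ↔ z = w ∨ z = w' ∨ z = n₂ ∨ z = n₃ ∨ z = n₄ ∨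
          z = f' ∨ z = x' ∨
          ∃ d ∈ D, ¬ (d = y ∨ d = t ∨ d = p ∨ d = q ∨ d = s ∨ d = p' ∨ d = q' ∨ d = t') ∧
              G.Adj d z := ⟨_, fun _ => Iff.rfl⟩
      have Pw : P w := (hP _).2 (by simp)
      have Pw' : P w' := (hP _).2 (by simp)
      have Pn₂ : P n₂ := (hP _).2 (by simp)
      have Pn₃ : P n₃ := (hP _).2 (by simp)
      have Pn₄ : P n₄ := (hP _).2 (by simp)
      have Pf' : P f' := (hP _).2 (by simp)
      have Px' : P x' := (hP _).2 (by simp)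
      have hg : ∀ z d, d ∈ D → G.Adj d z → P z ∨ d = y ∨ d = t ∨ d = p ∨ d = q ∨ d = s ∨ d = p' ∨
          d = q' ∨ d = t' := by
        intro z d h1 h2
        by_cases hR : d = y ∨ d = t ∨ d = p ∨ d = q ∨ d = s ∨ d = p' ∨ d = q' ∨ d = t'
        · exact Or.inr hR
        · refine Or.inl ((hP z).2 ?_)
          iterate 7 right
          exact ⟨d, h1, hR, h2⟩
      have Px0 : x = a → P x := by
        intro he
        obtain ⟨d, hd, i0, i1, i2, i3, i4, hadj⟩ := XA he
        have hg' := hg x d hd hadj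
        have ky := fun e : d = y => (hy x).1 (e ▸ hadj)
        have kt := fun e : d = t => (ht x).1 (e ▸ hadj)
        have kp := fun e : d = p => (hp x).1 (e ▸ hadj)
        have kq := fun e : d = q => (hq x).1 (e ▸ hadj)
        have ks := fun e : d = s => (hs x).1 (e ▸ hadj)
        have kp' := fun e : d = p' => (hp' x).1 (e ▸ hadj)
        have kq' := fun e : d = q' => (hq' x).1 (e ▸ hadj)
        have kt' := fun e : d = t' => (ht' x).1 (e ▸ hadj)
        clear hy hw hw' ht hp hq hs hp' hq' ht' hP hg F X A ea ef'
        grind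
      have Pa : P a := by
        obtain ⟨d, hd, i0, i1, hadj⟩ := A
        have hg' := hg a d hd hadj
        have ky := fun e : d = y => (hy a).1 (e ▸ hadj)
        have kt := fun e : d = t => (ht a).1 (e ▸ hadj)
        have kp := fun e : d = p => (hp a).1 (e ▸ hadj)
        have kq := fun e : d = q => (hq a).1 (e ▸ hadj)
        have ks := fun e : d = s => (hs a).1 (e ▸ hadj)
        have kp' := fun e : d = p' => (hp' a).1 (e ▸ hadj)
        have kq' := fun e : d = q' => (hq' a).1 (e ▸ hadj)
        have kt' := fun e : d = t' => (ht' a).1 (e ▸ hadj)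
        clear hy hw hw' ht hp hq hs hp' hq' ht' hP hg F X XA ea ef'
        grind
      have Pf : P f := by
        obtain ⟨d, hd, i0, i1, hadj⟩ := F
        have hg' := hg f d hd hadj
        have ky := fun e : d = y => (hy f).1 (e ▸ hadj)
        have kt := fun e : d = t => (ht f).1 (e ▸ hadj)
        have kp := fun e : d = p => (hp f).1 (e ▸ hadj)
        have kq := fun e : d = q => (hq f).1 (e ▸ hadj)
        have ks := fun e : d = s => (hs f).1 (e ▸ hadj)
        have kp' := fun e : d = p' => (hp' f).1 (e ▸ hadj)
        have kq' := fun e : d = q' => (hq' f).1 (e ▸ hadj)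
        have kt' := fun e : d = t' => (ht' f).1 (e ▸ hadj)
        clear hy hw hw' ht hp hq hs hp' hq' ht' hP hg X A XA ea ef'
        grind
      have Px : P x := by
        obtain ⟨d, hd, i0, i1, i2, hadj⟩ := X
        have hg' := hg x d hd hadj
        have ky := fun e : d = y => (hy x).1 (e ▸ hadj)
        have kt := fun e : d = t => (ht x).1 (e ▸ hadj)
        have kp := fun e : d = p => (hp x).1 (e ▸ hadj)
        have kq := fun e : d = q => (hq x).1 (e ▸ hadj)
        have ks := fun e : d = s => (hs x).1 (e ▸ hadj)
        have kp' := fun e : d = p' => (hp' x).1 (e ▸ hadj)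
        have kq' := fun e : d = q' => (hq' x).1 (e ▸ hadj)
        have kt' := fun e : d = t' => (ht' x).1 (e ▸ hadj)
        clear hy hw hw' ht hp hq hs hp' hq' ht' hP hg F A XA ea ef'
        grind
      -- Eight vertices against two centres and at most five repairs.
      have := hD.card_le_of_exchange (R := {y, t, p, q, s, p', q', t'}) (C := {w, w'})
        (Y := {n₂, n₃, n₄, f', x'}) (by simp [my, mt, mp, mq, ms, mp', mq', mt']) (by simp [nww',
            G.adj_comm w'])
        (by simpa using ⟨hE, hE'⟩) (by simp [hw, hw']) (by
          simp only [Finset.mem_insert, Finset.mem_singleton]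
          suffices h : ∀ r, r = y ∨ r = t ∨ r = p ∨ r = q ∨ r = s ∨ r = p' ∨ r = q' ∨ r = t' → ∀ z,
              G.Adj r z → P z by
            intro r hr z hz
            have := (hP z).1 (h r hr z hz)
            simpa only [or_assoc] using this
          clear hE
          simp only [forall_eq_or_imp, forall_eq]
          refine ⟨?_, ?_, ?_, ?_, ?_, ?_, ?_, ?_⟩
          · intro z hz
            rcases (hy z).1 hz with rfl | rfl | rfl | rfl | rfl <;> assumption
          · intro z hz
            rcases (ht z).1 hz with rfl | rfl | rfl <;> assumption
          · intro z hz
            rcases (hp z).1 hz with rfl | rfl | rfl <;> assumption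
          · intro z hz
            rcases (hq z).1 hz with rfl | rfl | rfl <;> assumption
          · intro z hz
            rcases (hs z).1 hz with rfl | rfl | rfl <;> assumption
          · intro z hz
            rcases (hp' z).1 hz with rfl | rfl | rfl <;> assumption
          · intro z hz
            rcases (hq' z).1 hz with rfl | rfl | rfl <;> assumption
          · intro z hz
            rcases (ht' z).1 hz with rfl | rfl | rfl <;> assumption)
      rw [Finset.card_pair ww'] at this
      have h2 := Finset.card_le_five (a := n₂) (b := n₃) (c := n₄) (d := f') (e := x')
      simp [yt, yp, yq, ys, yp', yq', yt', tp, tq, ts, Ne.symm tp', Ne.symm tq', Ne.symm tt', pq,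
          ps, Ne.symm pp', Ne.symm pq'', Ne.symm pt'', qs, Ne.symm qp', Ne.symm qq', Ne.symm qt'',
              sp', sq', st', pq', pt', qt'] at this
      omega
    · have mx' : x' ∈ D := by
        obtain ⟨d, hd, hd2⟩ := dom _ mt'
        rcases (ht' d).1 hd2.symm with rfl | rfl | rfl <;> first | assumption | contradiction
      have nq' : q' ∉ D := fun h => ind _ h _ mx' ((hq' _).2 (by simp))
      -- Here `f'` is no longer an allowed repair, so the coincidences `f = f'` and `f' = a`, where
      -- `p'` is a further neighbour of the common vertex, need their own exchanges.
      have FF : f = f' → ∃ d ∈ D, d ≠ p ∧ d ≠ q ∧ d ≠ p' ∧ G.Adj d f := by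
        intro hff
        by_contra! hX
        have hX' : ∀ d ∈ D, G.Adj f d → d = p ∨ d = q ∨ d = p' := fun d h1 h2 => by
          by_contra! h; exact hX d h1 h.1 h.2.1 h.2.2 h2.symm
        clear ind dom
        have := hD.card_le_of_exchange (R := {p, q, p'}) (C := {f}) (Y := ∅)
          (by simp [mp, mq, mp']) (by simp) (by simpa using hX')
          (by
            simp only [Finset.mem_insert, Finset.mem_singleton, forall_eq_or_imp, forall_eq,
                exists_eq_left]
            exact ⟨((hp _).2 (by simp [hff])).symm, ((hq _).2 (by simp [hff])).symm,
                ((hp' _).2 (by simp [hff])).symm⟩) (by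
            simp only [Finset.mem_insert, Finset.mem_singleton, Finset.notMem_empty]
            clear ef' A X XA F hX hX' hw hw'
            simp only [forall_eq_or_imp, forall_eq]
            refine ⟨?_, ?_, ?_⟩
            · intro z hz
              rcases (hp z).1 hz with rfl | rfl | rfl <;> grind
            · intro z hz
              rcases (hq z).1 hz with rfl | rfl | rfl <;> grind
            · intro z hz
              rcases (hp' z).1 hz with rfl | rfl | rfl <;> grind)
        simp [pq, Ne.symm pp', Ne.symm qp'] at this
      have FA : f' = a → ∃ d ∈ D, d ≠ t ∧ d ≠ p ∧ d ≠ p' ∧ G.Adj d a := by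
        intro hfa
        by_contra! hX
        have hX' : ∀ d ∈ D, G.Adj a d → d = t ∨ d = p ∨ d = p' := fun d h1 h2 => by
          by_contra! h; exact hX d h1 h.1 h.2.1 h.2.2 h2.symm
        clear ind dom
        have := hD.card_le_of_exchange (R := {t, p, p'}) (C := {a}) (Y := ∅)
          (by simp [mt, mp, mp']) (by simp) (by simpa using hX')
          (by
            simp only [Finset.mem_insert, Finset.mem_singleton, forall_eq_or_imp, forall_eq,
                exists_eq_left]
            exact ⟨((ht _).2 (by simp)).symm, ((hp _).2 (by simp)).symm,
                ((hp' _).2 (by simp [hfa])).symm⟩) (by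
            simp only [Finset.mem_insert, Finset.mem_singleton, Finset.notMem_empty]
            clear ef' A X XA FF hX hX' hw hw'
            simp only [forall_eq_or_imp, forall_eq]
            refine ⟨?_, ?_, ?_⟩
            · intro z hz
              rcases (ht z).1 hz with rfl | rfl | rfl <;> grind
            · intro z hz
              rcases (hp z).1 hz with rfl | rfl | rfl <;> grind
            · intro z hz
              rcases (hp' z).1 hz with rfl | rfl | rfl <;> grind)
        simp [tp, Ne.symm tp', Ne.symm pp'] at this
      have nww' : ¬ G.Adj w w' := fun h => by
        rcases (hw _).1 h with rfl | rfl | rfl | rfl | rfl <;> contradiction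
      have hE : ∀ d ∈ D, G.Adj w d → d = y ∨ d = t ∨ d = p ∨ d = q ∨ d = s ∨ d = p' := by
        intro d hd h
        rcases (hw d).1 h with h | h | h | h | h <;> simp [h]
      have hE' : ∀ d ∈ D, G.Adj w' d → d = y ∨ d = t ∨ d = p ∨ d = q ∨ d = s ∨ d = p' := by
        intro d hd h
        rcases (hw' d).1 h with rfl | rfl | rfl | rfl | rfl <;> first | contradiction | simp
      clear ind dom
      obtain ⟨P, hP⟩ : ∃ P : V → Prop, ∀ z, P z ↔ z = w ∨ z = w' ∨ z = n₂ ∨ z = n₃ ∨ z = n₄ ∨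
          ∃ d ∈ D, ¬ (d = y ∨ d = t ∨ d = p ∨ d = q ∨ d = s ∨ d = p') ∧ G.Adj d z := ⟨_,
              fun _ => Iff.rfl⟩
      have Pw : P w := (hP _).2 (by simp)
      have Pw' : P w' := (hP _).2 (by simp)
      have Pn₂ : P n₂ := (hP _).2 (by simp)
      have Pn₃ : P n₃ := (hP _).2 (by simp)
      have Pn₄ : P n₄ := (hP _).2 (by simp)
      have hg : ∀ z d, d ∈ D → G.Adj d z → P z ∨ d = y ∨ d = t ∨ d = p ∨ d = q ∨ d = s ∨ d = p' :=
          by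
        intro z d h1 h2
        by_cases hR : d = y ∨ d = t ∨ d = p ∨ d = q ∨ d = s ∨ d = p'
        · exact Or.inr hR
        · refine Or.inl ((hP z).2 ?_)
          iterate 5 right
          exact ⟨d, h1, hR, h2⟩
      have Pff : f = f' → P f := by
        intro he
        obtain ⟨d, hd, i0, i1, i2, hadj⟩ := FF he
        have hg' := hg f d hd hadj
        have ky := fun e : d = y => (hy f).1 (e ▸ hadj)
        have kt := fun e : d = t => (ht f).1 (e ▸ hadj)
        have kp := fun e : d = p => (hp f).1 (e ▸ hadj)
        have kq := fun e : d = q => (hq f).1 (e ▸ hadj)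
        have ks := fun e : d = s => (hs f).1 (e ▸ hadj)
        have kp' := fun e : d = p' => (hp' f).1 (e ▸ hadj)
        clear hy hw hw' ht hp hq hs hp' hq' ht' hP hg F X A XA ea ef' FA
        grind
      have Pfa : f' = a → P a := by
        intro he
        obtain ⟨d, hd, i0, i1, i2, hadj⟩ := FA he
        have hg' := hg a d hd hadj
        have ky := fun e : d = y => (hy a).1 (e ▸ hadj)
        have kt := fun e : d = t => (ht a).1 (e ▸ hadj)
        have kp := fun e : d = p => (hp a).1 (e ▸ hadj)
        have kq := fun e : d = q => (hq a).1 (e ▸ hadj)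
        have ks := fun e : d = s => (hs a).1 (e ▸ hadj)
        have kp' := fun e : d = p' => (hp' a).1 (e ▸ hadj)
        clear hy hw hw' ht hp hq hs hp' hq' ht' hP hg F X A XA ea ef' FF
        grind
      have Px0 : x = a → P x := by
        intro he
        obtain ⟨d, hd, i0, i1, i2, i3, i4, hadj⟩ := XA he
        have hg' := hg x d hd hadj
        have ky := fun e : d = y => (hy x).1 (e ▸ hadj)
        have kt := fun e : d = t => (ht x).1 (e ▸ hadj)
        have kp := fun e : d = p => (hp x).1 (e ▸ hadj)
        have kq := fun e : d = q => (hq x).1 (e ▸ hadj)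
        have ks := fun e : d = s => (hs x).1 (e ▸ hadj)
        have kp' := fun e : d = p' => (hp' x).1 (e ▸ hadj)
        clear hy hw hw' ht hp hq hs hp' hq' ht' hP hg F X A ea ef' FF FA
        grind
      have Pa : P a := by
        obtain ⟨d, hd, i0, i1, hadj⟩ := A
        have hg' := hg a d hd hadj
        have ky := fun e : d = y => (hy a).1 (e ▸ hadj)
        have kt := fun e : d = t => (ht a).1 (e ▸ hadj)
        have kp := fun e : d = p => (hp a).1 (e ▸ hadj)
        have kq := fun e : d = q => (hq a).1 (e ▸ hadj)
        have ks := fun e : d = s => (hs a).1 (e ▸ hadj)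
        have kp' := fun e : d = p' => (hp' a).1 (e ▸ hadj)
        clear hy hw hw' ht hp hq hs hp' hq' ht' hP hg F X XA ea ef' FF FA
        grind
      have Pf : P f := by
        obtain ⟨d, hd, i0, i1, hadj⟩ := F
        have hg' := hg f d hd hadj
        have ky := fun e : d = y => (hy f).1 (e ▸ hadj)
        have kt := fun e : d = t => (ht f).1 (e ▸ hadj)
        have kp := fun e : d = p => (hp f).1 (e ▸ hadj)
        have kq := fun e : d = q => (hq f).1 (e ▸ hadj)
        have ks := fun e : d = s => (hs f).1 (e ▸ hadj)
        have kp' := fun e : d = p' => (hp' f).1 (e ▸ hadj)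
        clear hy hw hw' ht hp hq hs hp' hq' ht' hP hg X A XA ea ef' FF FA
        grind
      have Px : P x := by
        obtain ⟨d, hd, i0, i1, i2, hadj⟩ := X
        have hg' := hg x d hd hadj
        have ky := fun e : d = y => (hy x).1 (e ▸ hadj)
        have kt := fun e : d = t => (ht x).1 (e ▸ hadj)
        have kp := fun e : d = p => (hp x).1 (e ▸ hadj)
        have kq := fun e : d = q => (hq x).1 (e ▸ hadj)
        have ks := fun e : d = s => (hs x).1 (e ▸ hadj)
        have kp' := fun e : d = p' => (hp' x).1 (e ▸ hadj)
        clear hy hw hw' ht hp hq hs hp' hq' ht' hP hg F A XA ea ef' FF FA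
        grind
      have Pf' : P f' := by
        obtain ⟨d, hd, i0, i1, hadj⟩ := ef'
        have hg' := hg f' d hd hadj
        have ky := fun e : d = y => (hy f').1 (e ▸ hadj)
        have kt := fun e : d = t => (ht f').1 (e ▸ hadj)
        have kp := fun e : d = p => (hp f').1 (e ▸ hadj)
        have kq := fun e : d = q => (hq f').1 (e ▸ hadj)
        have ks := fun e : d = s => (hs f').1 (e ▸ hadj)
        have kp' := fun e : d = p' => (hp' f').1 (e ▸ hadj)
        clear hy hw hw' ht hp hq hs hp' hq' ht' hP hg F X A XA ea FF FA
        grind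
      -- With `q', t' ∉ D`, six vertices stand against two centres and at most three repairs.
      have := hD.card_le_of_exchange (R := {y, t, p, q, s, p'}) (C := {w, w'})
        (Y := {n₂, n₃, n₄}) (by simp [my, mt, mp, mq, ms, mp']) (by simp [nww', G.adj_comm w'])
        (by simpa using ⟨hE, hE'⟩) (by simp [hw, hw']) (by
          simp only [Finset.mem_insert, Finset.mem_singleton]
          suffices h : ∀ r, r = y ∨ r = t ∨ r = p ∨ r = q ∨ r = s ∨ r = p' → ∀ z, G.Adj r z → P z by
            intro r hr z hz
            have := (hP z).1 (h r hr z hz)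
            simpa only [or_assoc] using this
          clear hE
          simp only [forall_eq_or_imp, forall_eq]
          refine ⟨?_, ?_, ?_, ?_, ?_, ?_⟩
          · intro z hz
            rcases (hy z).1 hz with rfl | rfl | rfl | rfl | rfl <;> assumption
          · intro z hz
            rcases (ht z).1 hz with rfl | rfl | rfl <;> assumption
          · intro z hz
            rcases (hp z).1 hz with rfl | rfl | rfl <;> assumption
          · intro z hz
            rcases (hq z).1 hz with rfl | rfl | rfl <;> assumption
          · intro z hz
            rcases (hs z).1 hz with rfl | rfl | rfl <;> assumption
          · intro z hz
            rcases (hp' z).1 hz with rfl | rfl | rfl <;> assumption)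
      rw [Finset.card_pair ww'] at this
      have h2 := Finset.card_le_three (a := n₂) (b := n₃) (c := n₄)
      simp [yt, yp, yq, ys, yp', tp, tq, ts, Ne.symm tp', pq, ps, Ne.symm pp', qs, Ne.symm qp',
          sp'] at this
      omega
  by_cases mt : t ∈ D
  · have hE : ∀ d ∈ D, G.Adj w d → d = t ∨ d = p ∨ d = q ∨ d = s := by
      intro d hd h
      rcases (hw d).1 h with rfl | rfl | rfl | rfl | rfl <;> first | contradiction | simp
    clear ind dom
    obtain ⟨P, hP⟩ : ∃ P : V → Prop, ∀ z, P z ↔ z = w ∨ z = n₄ ∨ z = a ∨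
        ∃ d ∈ D, ¬ (d = t ∨ d = p ∨ d = q ∨ d = s) ∧ G.Adj d z := ⟨_, fun _ => Iff.rfl⟩
    have Pw : P w := (hP _).2 (by simp)
    have Pn₄ : P n₄ := (hP _).2 (by simp)
    have Pa : P a := (hP _).2 (by simp)
    have hg : ∀ z d, d ∈ D → G.Adj d z → P z ∨ d = t ∨ d = p ∨ d = q ∨ d = s := by
      intro z d h1 h2
      by_cases hR : d = t ∨ d = p ∨ d = q ∨ d = s
      · exact Or.inr hR
      · refine Or.inl ((hP z).2 ?_)
        iterate 3 right
        exact ⟨d, h1, hR, h2⟩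
    have Pf : P f := by
      obtain ⟨d, hd, i0, i1, hadj⟩ := F
      have hg' := hg f d hd hadj
      have kt := fun e : d = t => (ht f).1 (e ▸ hadj)
      have kp := fun e : d = p => (hp f).1 (e ▸ hadj)
      have kq := fun e : d = q => (hq f).1 (e ▸ hadj)
      have ks := fun e : d = s => (hs f).1 (e ▸ hadj)
      clear hy hw hw' ht hp hq hs hp' hq' ht' hP hg X ea ef'
      grind
    have Px : P x := by
      obtain ⟨d, hd, i0, i1, i2, hadj⟩ := X
      have hg' := hg x d hd hadj
      have kt := fun e : d = t => (ht x).1 (e ▸ hadj)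
      have kp := fun e : d = p => (hp x).1 (e ▸ hadj)
      have kq := fun e : d = q => (hq x).1 (e ▸ hadj)
      have ks := fun e : d = s => (hs x).1 (e ▸ hadj)
      clear hy hw hw' ht hp hq hs hp' hq' ht' hP hg F ea ef'
      grind
    have Pw' : P w' := by
      rw [hP]
      iterate 3 right
      exact ⟨p', mp', by simp only [not_or]; exact ⟨tp', pp', qp', Ne.symm sp'⟩, pw'⟩
    have := hD.card_le_of_exchange (R := {t, p, q, s}) (C := {w})
      (Y := {n₄, a}) (by simp [mt, mp, mq, ms]) (by simp)
      (by simpa using hE) (by simp [hw]) (by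
        simp only [Finset.mem_insert, Finset.mem_singleton]
        suffices h : ∀ r, r = t ∨ r = p ∨ r = q ∨ r = s → ∀ z, G.Adj r z → P z by
          intro r hr z hz
          have := (hP z).1 (h r hr z hz)
          simpa only [or_assoc] using this
        clear hE
        simp only [forall_eq_or_imp, forall_eq]
        refine ⟨?_, ?_, ?_, ?_⟩
        · intro z hz
          rcases (ht z).1 hz with rfl | rfl | rfl <;> assumption
        · intro z hz
          rcases (hp z).1 hz with rfl | rfl | rfl <;> assumption
        · intro z hz
          rcases (hq z).1 hz with rfl | rfl | rfl <;> assumption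
        · intro z hz
          rcases (hs z).1 hz with rfl | rfl | rfl <;> assumption)
    have h2 := Finset.card_le_two (a := n₄) (b := a)
    simp [tp, tq, ts, pq, ps, qs] at this
    omega
  · have hE : ∀ d ∈ D, G.Adj w d → d = p ∨ d = q ∨ d = s := by
      intro d hd h
      rcases (hw d).1 h with rfl | rfl | rfl | rfl | rfl <;> first | contradiction | simp
    clear ind dom
    obtain ⟨P, hP⟩ : ∃ P : V → Prop, ∀ z, P z ↔ z = w ∨ z = x ∨
        ∃ d ∈ D, ¬ (d = p ∨ d = q ∨ d = s) ∧ G.Adj d z := ⟨_, fun _ => Iff.rfl⟩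
    have Pw : P w := (hP _).2 (by simp)
    have Px : P x := (hP _).2 (by simp)
    have hg : ∀ z d, d ∈ D → G.Adj d z → P z ∨ d = p ∨ d = q ∨ d = s := by
      intro z d h1 h2
      by_cases hR : d = p ∨ d = q ∨ d = s
      · exact Or.inr hR
      · refine Or.inl ((hP z).2 ?_)
        iterate 2 right
        exact ⟨d, h1, hR, h2⟩
    have Pf : P f := by
      obtain ⟨d, hd, i0, i1, hadj⟩ := F
      have hg' := hg f d hd hadj
      have kp := fun e : d = p => (hp f).1 (e ▸ hadj)
      have kq := fun e : d = q => (hq f).1 (e ▸ hadj)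
      have ks := fun e : d = s => (hs f).1 (e ▸ hadj)
      clear hy hw hw' ht hp hq hs hp' hq' ht' hP hg X ea ef'
      grind
    have Pa : P a := by
      obtain ⟨d, hd, i0, i1, hadj⟩ := ea
      have hg' := hg a d hd hadj
      have kp := fun e : d = p => (hp a).1 (e ▸ hadj)
      have kq := fun e : d = q => (hq a).1 (e ▸ hadj)
      have ks := fun e : d = s => (hs a).1 (e ▸ hadj)
      clear hy hw hw' ht hp hq hs hp' hq' ht' hP hg F X ef'
      grind
    have Pw' : P w' := by
      rw [hP]
      iterate 2 right
      exact ⟨p', mp', by simp only [not_or]; exact ⟨pp', qp', Ne.symm sp'⟩, pw'⟩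
    have := hD.card_le_of_exchange (R := {p, q, s}) (C := {w})
      (Y := {x}) (by simp [mp, mq, ms]) (by simp)
      (by simpa using hE) (by simp [hw]) (by
        simp only [Finset.mem_insert, Finset.mem_singleton]
        suffices h : ∀ r, r = p ∨ r = q ∨ r = s → ∀ z, G.Adj r z → P z by
          intro r hr z hz
          have := (hP z).1 (h r hr z hz)
          simpa only [or_assoc] using this
        clear hE
        simp only [forall_eq_or_imp, forall_eq]
        refine ⟨?_, ?_, ?_⟩
        · intro z hz
          rcases (hp z).1 hz with rfl | rfl | rfl <;> assumption
        · intro z hz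
          rcases (hq z).1 hz with rfl | rfl | rfl <;> assumption
        · intro z hz
          rcases (hs z).1 hz with rfl | rfl | rfl <;> assumption)
    simp [pq, ps, qs] at this

end SimpleGraph

/-! ### Cycles of a permutation -/

namespace Equiv.Perm

variable {α : Type*}

theorem isCycleOn_setOf_sameCycle (f : Equiv.Perm α) (x : α) :
    f.IsCycleOn {y | f.SameCycle x y} := by
  refine ⟨⟨fun y hy => ?_, f.injective.injOn, fun y hy => ⟨f.symm y, ?_, by simp⟩⟩,
    fun y hy z hz => ?_⟩
  · exact sameCycle_apply_right.2 hy
  · exact sameCycle_symm_apply_right.2 hy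
  · exact (Set.mem_ofPred.1 hy).symm.trans hz

theorem pow_ncard_sameCycle [Finite α] (f : Equiv.Perm α) (x : α) :
    (f ^ {y | f.SameCycle x y}.ncard) x = x := by
  classical
  have h := Set.toFinite {y | f.SameCycle x y}
  rw [Set.ncard_eq_toFinset_card _ h]
  have := f.isCycleOn_setOf_sameCycle x
  rw [← h.coe_toFinset] at this
  exact this.pow_card_apply (by simp [SameCycle.refl])

theorem ncard_sameCycle_apply (f : Equiv.Perm α) (x : α) :
    {y | f.SameCycle (f x) y}.ncard = {y | f.SameCycle x y}.ncard := by
  simp only [sameCycle_apply_left]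

theorem pow_apply_ne_of_lt_ncard [Finite α] (f : Equiv.Perm α) (x : α) {m n : ℕ}
    (hm : m < {y | f.SameCycle x y}.ncard) (hn : n < {y | f.SameCycle x y}.ncard) (hmn : m ≠ n) :
    (f ^ m) x ≠ (f ^ n) x := by
  classical
  have h := Set.toFinite {y | f.SameCycle x y}
  rw [Set.ncard_eq_toFinset_card _ h] at hm hn
  have := f.isCycleOn_setOf_sameCycle x
  rw [← h.coe_toFinset] at this
  rw [Ne, this.pow_apply_eq_pow_apply (by simp [SameCycle.refl])]
  intro h'
  exact hmn (by rw [Nat.ModEq, Nat.mod_eq_of_lt hm, Nat.mod_eq_of_lt hn] at h'; exact h')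

theorem exists_pow_eq_of_sameCycle [Finite α] (f : Equiv.Perm α) {x y : α} (hxy : f.SameCycle x y) :
    ∃ n < {y | f.SameCycle x y}.ncard, (f ^ n) x = y := by
  classical
  have h := Set.toFinite {y | f.SameCycle x y}
  rw [Set.ncard_eq_toFinset_card _ h]
  have := f.isCycleOn_setOf_sameCycle x
  rw [← h.coe_toFinset] at this
  exact this.exists_pow_eq (by simp [SameCycle.refl]) (by simpa)

/-- The reciprocals of the cycle lengths sum up to the number of cycles. -/
theorem sum_inv_ncard_sameCycle {α : Type*} [Fintype α] (f : Equiv.Perm α) :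
    ∑ x, (({y | f.SameCycle x y}.ncard : ℚ))⁻¹ =
      Nat.card (Quotient (SameCycle.setoid f)) := by
  classical
  rw [Nat.card_eq_fintype_card,
    ← Finset.sum_fiberwise (s := Finset.univ) (g := fun x : α => (Quotient.mk (SameCycle.setoid f)
        x)),
    Fintype.card_eq_sum_ones, Nat.cast_sum]
  refine Finset.sum_congr rfl fun c _ => ?_
  induction c using Quotient.inductionOn with
  | h x =>
  have hmem : ∀ z, (Quotient.mk (SameCycle.setoid f) z = Quotient.mk (SameCycle.setoid f) x) ↔
      f.SameCycle x z := fun z => by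
    rw [Quotient.eq]
    exact sameCycle_comm
  rw [Finset.sum_congr rfl (g := fun _ => (({y | f.SameCycle x y}.ncard : ℚ))⁻¹)]
  · rw [Finset.sum_const]
    have : {y | f.SameCycle x y}.ncard =
        (Finset.univ.filter fun z => Quotient.mk (SameCycle.setoid f) z =
          Quotient.mk (SameCycle.setoid f) x).card := by
      rw [← Set.ncard_coe_finset]
      congr 1
      ext z
      simp [hmem]
    rw [← this, nsmul_eq_mul, Nat.cast_one]
    refine mul_inv_cancel₀ ?_
    have : 0 < {y | f.SameCycle x y}.ncard := (Set.ncard_pos).2 ⟨x, SameCycle.refl f x⟩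
    positivity
  · intro z hz
    have hz' := (hmem z).1 (Finset.mem_filter.1 hz).2
    congr 3
    ext y
    exact ⟨hz'.trans, hz'.symm.trans⟩

end Equiv.Perm

/-! ### Vertex rotations and quadrilateral faces -/

namespace SimpleGraph

variable {V : Type*} {G : SimpleGraph V}

theorem Dart.eq_of_fst_snd {d d' : G.Dart} (h₁ : d.fst = d'.fst) (h₂ : d.snd = d'.snd) : d = d' :=
  Dart.ext _ _ (Prod.ext h₁ h₂)

namespace RotationSystem

variable (R : RotationSystem G)

@[simp]
theorem next_fst (d : G.Dart) : (R.next d).fst = d.fst :=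
  ((R.sameCycle_iff _ _).1 (Equiv.Perm.sameCycle_apply_right.2 (.refl _ d))).symm

@[simp]
theorem next_symm_fst (d : G.Dart) : (R.next.symm d).fst = d.fst := by
  rw [← R.next_fst, Equiv.apply_symm_apply]

theorem next_pow_fst (d : G.Dart) (n : ℕ) : ((R.next ^ n) d).fst = d.fst :=
  ((R.sameCycle_iff _ _).1 ⟨n, by simp⟩).symm

theorem facePerm_apply (d : G.Dart) : R.facePerm d = R.next d.symm := rfl

theorem facePerm_symm (d : G.Dart) : R.facePerm d.symm = R.next d := by
  rw [facePerm_apply, Dart.symm_symm]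

theorem adj_next_pow (d : G.Dart) (n : ℕ) : G.Adj d.fst ((R.next ^ n) d).snd := by
  have := ((R.next ^ n) d).adj
  rwa [next_pow_fst] at this

/-- The number of darts on the boundary walk of the face of `d`. -/
noncomputable def faceLength (d : G.Dart) : ℕ := {d' | R.facePerm.SameCycle d d'}.ncard

theorem faceLength_facePerm (d : G.Dart) : R.faceLength (R.facePerm d) = R.faceLength d :=
  Equiv.Perm.ncard_sameCycle_apply _ _

section Finite

variable [Fintype V] [DecidableRel G.Adj]

theorem ncard_sameCycle_next (d : G.Dart) :
    {d' | R.next.SameCycle d d'}.ncard = G.degree d.fst := by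
  classical
  rw [← G.dart_fst_fiber_card_eq_degree, ← Set.ncard_coe_finset]
  congr 1
  ext d'
  simp [R.sameCycle_iff, eq_comm]

theorem next_pow_degree (d : G.Dart) : (R.next ^ G.degree d.fst) d = d := by
  rw [← R.ncard_sameCycle_next]
  exact Equiv.Perm.pow_ncard_sameCycle _ _

theorem next_pow_ne {d : G.Dart} {m n : ℕ} (hm : m < G.degree d.fst) (hn : n < G.degree d.fst)
    (hmn : m ≠ n) : (R.next ^ m) d ≠ (R.next ^ n) d := by
  rw [← R.ncard_sameCycle_next] at hm hn
  exact Equiv.Perm.pow_apply_ne_of_lt_ncard _ _ hm hn hmn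

theorem next_pow_snd_ne {d : G.Dart} {m n : ℕ} (hm : m < G.degree d.fst)
    (hn : n < G.degree d.fst) (hmn : m ≠ n) :
    ((R.next ^ m) d).snd ≠ ((R.next ^ n) d).snd := fun h =>
  R.next_pow_ne hm hn hmn (Dart.eq_of_fst_snd (by simp only [next_pow_fst]) h)

theorem exists_next_pow_snd_eq (d : G.Dart) {z : V} (h : G.Adj d.fst z) :
    ∃ n < G.degree d.fst, ((R.next ^ n) d).snd = z := by
  obtain ⟨n, hn, h'⟩ := Equiv.Perm.exists_pow_eq_of_sameCycle R.next
    ((R.sameCycle_iff d ⟨(d.fst, z), h⟩).2 rfl)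
  exact ⟨n, R.ncard_sameCycle_next d ▸ hn, by rw [h']⟩

theorem next_snd_ne {d : G.Dart} (h : 2 ≤ G.degree d.fst) : (R.next d).snd ≠ d.snd :=
  R.next_pow_snd_ne (m := 1) (n := 0) (by omega) (by omega) (by omega)

theorem next_next_snd_ne {d : G.Dart} (h : 3 ≤ G.degree d.fst) :
    (R.next (R.next d)).snd ≠ d.snd :=
  R.next_pow_snd_ne (m := 2) (n := 0) (by omega) (by omega) (by omega)

theorem next_next_next_of_degree {d : G.Dart} (h : G.degree d.fst = 3) :
    R.next (R.next (R.next d)) = d := by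
  have := R.next_pow_degree d
  rw [h] at this
  exact this

theorem next_symm_eq_of_degree {d : G.Dart} (h : G.degree d.fst = 3) :
    R.next.symm d = R.next (R.next d) := by
  rw [Equiv.symm_apply_eq, R.next_next_next_of_degree h]

theorem adj_iff_of_degree_eq_three {d : G.Dart} (h : G.degree d.fst = 3) (z : V) :
    G.Adj d.fst z ↔ z = d.snd ∨ z = (R.next d).snd ∨ z = (R.next.symm d).snd := by
  rw [R.next_symm_eq_of_degree h]
  constructor
  · intro hz
    obtain ⟨n, hn, rfl⟩ := R.exists_next_pow_snd_eq d hz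
    rw [h] at hn
    interval_cases n <;> simp [pow_succ]
  · rintro (rfl | rfl | rfl)
    · exact R.adj_next_pow d 0
    · exact R.adj_next_pow d 1
    · exact R.adj_next_pow d 2

theorem nodup_of_degree_eq_three {d : G.Dart} (h : G.degree d.fst = 3) :
    [d.snd, (R.next d).snd, (R.next.symm d).snd].Nodup := by
  have := R.next_pow_snd_ne (d := d) (m := 0) (n := 1) (by omega) (by omega) (by omega)
  have := R.next_pow_snd_ne (d := d) (m := 0) (n := 2) (by omega) (by omega) (by omega)
  have := R.next_pow_snd_ne (d := d) (m := 1) (n := 2) (by omega) (by omega) (by omega)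
  rw [R.next_symm_eq_of_degree h]
  simp_all [pow_succ]

theorem next_symm_eq_of_degree_eq_five {d : G.Dart} (h : G.degree d.fst = 5) :
    R.next.symm d = R.next (R.next (R.next (R.next d))) := by
  rw [Equiv.symm_apply_eq]
  have := R.next_pow_degree d
  rw [h] at this
  exact this.symm

theorem adj_iff_of_degree_eq_five {d : G.Dart} (h : G.degree d.fst = 5) (z : V) :
    G.Adj d.fst z ↔ z = d.snd ∨ z = (R.next d).snd ∨ z = (R.next (R.next d)).snd ∨
      z = (R.next (R.next (R.next d))).snd ∨ z = (R.next.symm d).snd := by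
  rw [R.next_symm_eq_of_degree_eq_five h]
  constructor
  · intro hz
    obtain ⟨n, hn, rfl⟩ := R.exists_next_pow_snd_eq d hz
    rw [h] at hn
    interval_cases n <;> simp [pow_succ]
  · rintro (rfl | rfl | rfl | rfl | rfl)
    · exact R.adj_next_pow d 0
    · exact R.adj_next_pow d 1
    · exact R.adj_next_pow d 2
    · exact R.adj_next_pow d 3
    · exact R.adj_next_pow d 4

theorem nodup_of_degree_eq_five {d : G.Dart} (h : G.degree d.fst = 5) :
    [d.snd, (R.next d).snd, (R.next (R.next d)).snd, (R.next (R.next (R.next d))).snd,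
      (R.next.symm d).snd].Nodup := by
  have key : ((List.range 5).map fun n => ((R.next ^ n) d).snd).Nodup := by
    refine (List.nodup_map_iff_inj_on List.nodup_range).2 fun m hm n hn hmn => ?_
    by_contra hne
    rw [List.mem_range, ← h] at hm hn
    exact R.next_pow_snd_ne hm hn hne hmn
  rw [R.next_symm_eq_of_degree_eq_five h]
  exact key

theorem facePerm_pow_faceLength (d : G.Dart) : (R.facePerm ^ R.faceLength d) d = d :=
  Equiv.Perm.pow_ncard_sameCycle _ _

/-- Around a face of length four, opposite walks from a corner meet. -/
theorem next_symm_of_faceLength_eq_four {d : G.Dart} (h : R.faceLength (R.next d) = 4) :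
    R.next (R.next (R.next d).symm).symm = (R.next.symm d.symm).symm := by
  have h4 := R.facePerm_pow_faceLength (R.next d)
  rw [h] at h4
  -- The face walk reaches `next d` from `d.symm`, so after three steps from `next d` a walk of
  -- length four is at `d.symm`.
  have h3 : R.facePerm (R.facePerm (R.facePerm (R.next d))) = d.symm :=
    R.facePerm.injective (h4.trans (R.facePerm_symm d).symm)
  simp only [facePerm_apply] at h3
  rw [← h3, Equiv.symm_apply_apply, Dart.symm_symm]

theorem next_symm_snd_of_faceLength_eq_four {d : G.Dart} (h : R.faceLength (R.next d) = 4) :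
    (R.next (R.next d).symm).snd = (R.next.symm d.symm).snd := by
  have := congrArg (fun e : G.Dart => e.fst) (R.next_symm_of_faceLength_eq_four h)
  simpa using this

end Finite

end RotationSystem

end SimpleGraph

/-! ### Euler's formula and the face lengths -/

namespace SimpleGraph

variable {V : Type*} {G : SimpleGraph V}

namespace RotationSystem

variable (R : RotationSystem G)

theorem sum_inv_faceLength [Fintype G.Dart] :
    ∑ d : G.Dart, ((R.faceLength d : ℚ))⁻¹ = Nat.card R.Face :=
  Equiv.Perm.sum_inv_ncard_sameCycle R.facePerm

variable [Fintype V] [DecidableRel G.Adj]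

theorem sum_inv_degree_fst [Fintype G.Dart] (h : ∀ v, 0 < G.degree v) :
    ∑ d : G.Dart, ((G.degree d.fst : ℚ))⁻¹ = Fintype.card V := by
  classical
  rw [← Finset.sum_fiberwise (s := Finset.univ) (g := fun d : G.Dart => d.fst),
    Fintype.card_eq_sum_ones, Nat.cast_sum]
  refine Finset.sum_congr rfl fun v _ => ?_
  rw [Finset.sum_congr rfl (g := fun _ => ((G.degree v : ℚ))⁻¹)
    (fun d hd => by rw [(Finset.mem_filter.1 hd).2]), Finset.sum_const, nsmul_eq_mul,
    Nat.cast_one]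
  have hc := G.dart_fst_fiber_card_eq_degree v
  have hv := h v
  rw [show (Finset.univ.filter fun d : G.Dart => d.fst = v).card = G.degree v by
    rw [← hc]; congr!]
  field_simp

/-- Euler's formula as a sum over darts. -/
theorem sum_curvature_eq [Fintype G.Dart] (hR : R.IsSpherical) (hconn : G.Connected)
    (h : ∀ v, 0 < G.degree v) :
    ∑ d : G.Dart, ((1 - 4 / (G.degree d.fst : ℚ)) + (1 - 4 / (R.faceLength d : ℚ))) = -8 := by
  classical
  have h1 := sum_inv_degree_fst h
  have h2 := R.sum_inv_faceLength
  have h3 : (Fintype.card G.Dart : ℚ) = 2 * Nat.card G.edgeSet := by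
    have h : Fintype.card G.Dart = 2 * G.edgeFinset.card := by
      convert G.dart_card_eq_twice_card_edges
    rw [Nat.card_eq_fintype_card, ← edgeFinset_card, h]
    push_cast
    rfl
  have h4 : Nat.card {v : V // ∀ w, ¬ G.Adj v w} = 0 := by
    rw [Nat.card_eq_zero]
    refine Or.inl ⟨fun ⟨v, hv⟩ => ?_⟩
    obtain ⟨w, hw⟩ := (G.degree_pos_iff_exists_adj v).1 (h v)
    exact hv w hw
  have h5 : Nat.card G.ConnectedComponent = 1 := by
    rw [Nat.card_eq_one_iff_unique]
    exact ⟨hconn.preconnected.subsingleton_connectedComponent,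
      ⟨G.connectedComponentMk hconn.nonempty.some⟩⟩
  have h6 := hR
  rw [IsSpherical, numFaces, h4, h5, Nat.card_eq_fintype_card] at h6
  have h7 : (Fintype.card V : ℚ) + Nat.card R.Face = Nat.card G.edgeSet + 2 := by
    exact_mod_cast h6
  have h8 : ∑ d : G.Dart, ((1 - 4 / (G.degree d.fst : ℚ)) + (1 - 4 / (R.faceLength d : ℚ))) =
      2 * (Fintype.card G.Dart : ℚ) - 4 * ∑ d : G.Dart, ((G.degree d.fst : ℚ))⁻¹
        - 4 * ∑ d : G.Dart, ((R.faceLength d : ℚ))⁻¹ := by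
    rw [Finset.mul_sum, Finset.mul_sum, ← Finset.card_univ, ← nsmul_one, ← Finset.sum_const,
      Finset.mul_sum, ← Finset.sum_sub_distrib, ← Finset.sum_sub_distrib]
    exact Finset.sum_congr rfl fun d _ => by ring
  rw [h8, h1, h2, h3]
  linarith

/-- A face walk of length 1 would be a loop, one of length 2 would turn back at a vertex of degree
1, and one of length 3 would be a triangle. -/
theorem four_le_faceLength (hdeg : ∀ v, 3 ≤ G.degree v)
    (htri : ∀ a b c, G.Adj a b → G.Adj b c → ¬ G.Adj a c) (d : G.Dart) : 4 ≤ R.faceLength d := by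
  have hp := R.facePerm_pow_faceLength d
  have hpos : 0 < R.faceLength d :=
    (Set.ncard_pos (Set.toFinite _)).2 ⟨d, Equiv.Perm.SameCycle.refl _ d⟩
  by_contra! hlt
  have hφ : ∀ e : G.Dart, (R.facePerm e).fst = e.snd := fun e => by
    rw [facePerm_apply, next_fst]; rfl
  have hne : ∀ e : G.Dart, (R.facePerm e).snd ≠ e.fst := fun e => by
    have := R.next_snd_ne (d := e.symm) ((hdeg _).trans' (by norm_num))
    exact this
  interval_cases hl : R.faceLength d
  · have h := hφ d
    rw [show R.facePerm d = d from hp] at h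
    exact d.fst_ne_snd h
  · have h := hne d
    have h' := hφ (R.facePerm d)
    rw [show R.facePerm (R.facePerm d) = d from hp] at h'
    exact h h'.symm
  · have h1 := hφ d
    have h2 := hφ (R.facePerm d)
    have h3 := hφ (R.facePerm (R.facePerm d))
    rw [show R.facePerm (R.facePerm (R.facePerm d)) = d from hp] at h3
    have a1 := d.adj
    have a2 := (R.facePerm d).adj
    have a3 := (R.facePerm (R.facePerm d)).adj
    rw [h1] at a2
    rw [h2, ← h3] at a3
    exact htri _ _ _ a1 a2 a3.symm

end RotationSystem

theorem not_adj_of_four_le_egirth (h : 4 ≤ G.egirth) (a b c : V) (hab : G.Adj a b)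
    (hbc : G.Adj b c) : ¬ G.Adj a c := by
  intro hac
  have hc : (Walk.cons hab (Walk.cons hbc (Walk.cons hac.symm Walk.nil))).IsCycle := by
    rw [Walk.cons_isCycle_iff]
    simp [hab.ne, hbc.ne, hac.ne, hab.ne', hac.ne']
  have := le_egirth.1 h a _ hc
  simp at this
  exact absurd this (by decide)

end SimpleGraph

/-! ### Excluded quadrilateral corners at a 5-vertex -/

namespace SimpleGraph

theorem nodup_three_swap {α : Type*} {a b c : α} (h : [a, b, c].Nodup) : [a, c, b].Nodup :=
  (List.Perm.nodup_iff ((List.Perm.swap b c []).cons a)).2 h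

theorem or_three_swap {p q r : Prop} : p ∨ q ∨ r ↔ p ∨ r ∨ q := or_congr_right or_comm

theorem or_five_reverse {p q r s t : Prop} : p ∨ q ∨ r ∨ s ∨ t ↔ t ∨ s ∨ r ∨ q ∨ p := by tauto

theorem or_five_rotate {p q r s t : Prop} : p ∨ q ∨ r ∨ s ∨ t ↔ q ∨ r ∨ s ∨ t ∨ p := by tauto

variable {V : Type*} {G : SimpleGraph V} [Fintype V] [DecidableRel G.Adj]

/-- This is the only coincidence pattern that survives the exchanges. It is not symmetric under
reversing the chain, so a chain readable in both directions yields a contradiction. -/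
theorem not_isChain_of_lt_bondage (hb : 6 < G.independentBondageNumber)
    (htri : ∀ a b c, G.Adj a b → G.Adj b c → ¬ G.Adj a c)
    {w u₁ u₂ u₃ u₄ v x₀ x₁ x₂ x₃ x₄ b c : V}
    (hd₁ : G.degree u₁ = 3) (hd₃ : G.degree u₃ = 3)
    (hw : ∀ z, G.Adj w z ↔ z = u₁ ∨ z = u₂ ∨ z = u₃ ∨ z = u₄ ∨ z = v)
    (hu : [u₁, u₂, u₃, u₄, v].Nodup)
    (h₁ : ∀ z, G.Adj u₁ z ↔ z = w ∨ z = x₀ ∨ z = x₁) (d₁ : [w, x₀, x₁].Nodup)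
    (h₂ : ∀ z, G.Adj u₂ z ↔ z = w ∨ z = x₁ ∨ z = x₂) (d₂ : [w, x₁, x₂].Nodup)
    (h₃ : ∀ z, G.Adj u₃ z ↔ z = w ∨ z = x₂ ∨ z = x₃) (d₃ : [w, x₂, x₃].Nodup)
    (h₄ : ∀ z, G.Adj u₄ z ↔ z = w ∨ z = x₃ ∨ z = x₄) (d₄ : [w, x₃, x₄].Nodup)
    (hv : ∀ z, G.Adj v z → z = w ∨ z = x₄ ∨ z = b ∨ z = c) (hvx : G.Adj v x₄) :
    x₀ = x₂ ∧ x₁ = x₃ ∧ x₄ ≠ x₂ := by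
  by_contra H
  have a₁ : G.Adj w u₁ := (hw _).2 (by simp)
  have a₃ : G.Adj w u₃ := (hw _).2 (by simp)
  have hne : u₁ ≠ u₃ := by
    rintro rfl
    simp at hu
  obtain ⟨D, hD⟩ := exists_isRedundantPair hb hne (htri _ _ _ a₁.symm a₃) hd₁ hd₃
  refine hD.false_of_chain hw hu h₁ d₁ h₂ d₂ h₃ d₃ h₄ d₄ hv hvx fun h h' => ?_
  by_contra h''
  exact H ⟨h, h', h''⟩

namespace RotationSystem

variable (R : RotationSystem G)

/-- The four corners at a vertex of degree five between five neighbors of degree three cannot all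
lie in faces of length four. -/
theorem false_of_four_corners (hb : 6 < G.independentBondageNumber)
    (htri : ∀ a b c, G.Adj a b → G.Adj b c → ¬ G.Adj a c) {d : G.Dart}
    (h5 : G.degree d.fst = 5) (h3 : ∀ z, G.Adj d.fst z → G.degree z = 3)
    (l₁ : R.faceLength (R.next d) = 4) (l₂ : R.faceLength (R.next (R.next d)) = 4)
    (l₃ : R.faceLength (R.next (R.next (R.next d))) = 4)
    (l₄ : R.faceLength (R.next (R.next (R.next (R.next d)))) = 4) : False := by
  have hw := R.adj_iff_of_degree_eq_five h5
  have hu := R.nodup_of_degree_eq_five h5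
  rw [R.next_symm_eq_of_degree_eq_five h5] at hu hw
  have hdeg : ∀ e : G.Dart, e.fst = d.fst → G.degree e.symm.fst = 3 := fun e he =>
    h3 _ (he ▸ e.adj)
  have e₁ := R.next_symm_snd_of_faceLength_eq_four l₁
  have e₂ := R.next_symm_snd_of_faceLength_eq_four l₂
  have e₃ := R.next_symm_snd_of_faceLength_eq_four l₃
  have e₄ := R.next_symm_snd_of_faceLength_eq_four l₄
  clear l₁ l₂ l₃ l₄
  have f₁ : (R.next d).fst = d.fst := by simp
  have f₂ : (R.next (R.next d)).fst = d.fst := by simp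
  have f₃ : (R.next (R.next (R.next d))).fst = d.fst := by simp
  have f₄ : (R.next (R.next (R.next (R.next d)))).fst = d.fst := by simp
  generalize R.next (R.next (R.next (R.next d))) = d₄ at *
  generalize R.next (R.next (R.next d)) = d₃ at *
  generalize R.next (R.next d) = d₂ at *
  generalize R.next d = d₁ at *
  have key : ∀ e : G.Dart, e.fst = d.fst →
      (∀ z, G.Adj e.snd z ↔ z = d.fst ∨ z = (R.next e.symm).snd ∨ z = (R.next.symm e.symm).snd) ∧
      [d.fst, (R.next e.symm).snd, (R.next.symm e.symm).snd].Nodup := fun e he => by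
    have h1 := R.adj_iff_of_degree_eq_three (hdeg e he)
    have h2 := R.nodup_of_degree_eq_three (hdeg e he)
    rw [← he]
    exact ⟨h1, h2⟩
  obtain ⟨n₀, m₀⟩ := key d rfl
  obtain ⟨n₁, m₁⟩ := key d₁ f₁
  obtain ⟨n₂, m₂⟩ := key d₂ f₂
  obtain ⟨n₃, m₃⟩ := key d₃ f₃
  obtain ⟨n₄, m₄⟩ := key d₄ f₄
  rw [e₁] at n₁ m₁
  rw [e₂] at n₂ m₂
  rw [e₃] at n₃ m₃
  rw [e₄] at n₄ m₄
  -- Four quadrilateral corners give a chain from `d` to `d₄`; all five neighbours have degree 3, so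
  -- the reversed order is a chain as well.
  have c := not_isChain_of_lt_bondage hb htri (hdeg d rfl) (hdeg d₂ f₂) hw hu n₀ m₀ n₁ m₁ n₂ m₂
    n₃ m₃ (v := d₄.snd) (b := (R.next.symm d₄.symm).snd) (c := (R.next.symm d₄.symm).snd)
    (fun z hz => ((n₄ z).1 hz).imp_right (Or.imp_right Or.inl)) ((n₄ _).2 (by simp))
  have c' := not_isChain_of_lt_bondage hb htri (hdeg d₄ f₄) (hdeg d₂ f₂)
    (u₁ := d₄.snd) (u₂ := d₃.snd) (u₃ := d₂.snd) (u₄ := d₁.snd) (v := d.snd)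
    (fun z => (hw z).trans or_five_reverse)
    ((List.reverse_perm _).nodup_iff.2 hu)
    (fun z => (n₄ z).trans or_three_swap) (nodup_three_swap m₄)
    (fun z => (n₃ z).trans or_three_swap) (nodup_three_swap m₃)
    (fun z => (n₂ z).trans or_three_swap) (nodup_three_swap m₂)
    (fun z => (n₁ z).trans or_three_swap) (nodup_three_swap m₁)
    (b := (R.next d.symm).snd) (c := (R.next d.symm).snd)
    (fun z hz => (or_three_swap.1 ((n₀ z).1 hz)).imp_right (Or.imp_right Or.inl))
        ((n₀ _).2 (by simp))
  -- The forward chain excludes `x₄ = x₂`, while the backward chain asserts it as its second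
  -- coincidence.
  exact c.2.2 c'.2.1

/-- The vertex `v` has degree five, exactly four neighbors of degree three, and all its corners lie
in faces of length four. -/
def IsNeedy (v : V) : Prop :=
  G.degree v = 5 ∧ (∃ u, G.Adj v u ∧ G.degree u ≠ 3 ∧ ∀ z, G.Adj v z → z ≠ u → G.degree z = 3) ∧
    ∀ d : G.Dart, d.fst = v → R.faceLength d = 4

theorem IsNeedy.degree_eq_three {R : RotationSystem G} {v u z : V} (h : R.IsNeedy v)
    (hu : G.Adj v u) (hu3 : G.degree u ≠ 3) (hz : G.Adj v z) (hzu : z ≠ u) : G.degree z = 3 := by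
  obtain ⟨-, ⟨u', -, -, h'⟩, -⟩ := h
  have huu' : u = u' := by
    by_contra hne
    exact hu3 (h' u hu hne)
  exact h' z hz (huu' ▸ hzu)

/-- A vertex of degree four has no needy neighbor. -/
theorem not_isNeedy_of_degree_eq_four (hb : 6 < G.independentBondageNumber)
    (htri : ∀ a b c, G.Adj a b → G.Adj b c → ¬ G.Adj a c) {d : G.Dart}
    (h4 : G.degree d.snd = 4) : ¬ R.IsNeedy d.fst := by
  intro hn
  have h5 := hn.1
  have hL := hn.2.2
  have hw := R.adj_iff_of_degree_eq_five h5
  have hu := R.nodup_of_degree_eq_five h5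
  have h5' := R.next_symm_eq_of_degree_eq_five h5
  rw [h5'] at hu hw
  have h5'' := R.next.symm_apply_eq.1 h5'
  have l₀ := hL d rfl
  have l₁ := hL (R.next d) (by simp)
  have l₂ := hL (R.next (R.next d)) (by simp)
  have l₃ := hL (R.next (R.next (R.next d))) (by simp)
  have l₄ := hL (R.next (R.next (R.next (R.next d)))) (by simp)
  have l₅ : R.faceLength (R.next (R.next (R.next (R.next (R.next d))))) = 4 := by
    rw [← h5'']; exact l₀
  have e₁ := R.next_symm_snd_of_faceLength_eq_four l₁
  have e₂ := R.next_symm_snd_of_faceLength_eq_four l₂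
  have e₃ := R.next_symm_snd_of_faceLength_eq_four l₃
  have e₄ := R.next_symm_snd_of_faceLength_eq_four l₄
  have e₅ := R.next_symm_snd_of_faceLength_eq_four l₅
  rw [← h5''] at e₅
  clear l₀ l₁ l₂ l₃ l₄ l₅ h5' h5''
  have f₁ : (R.next d).fst = d.fst := by simp
  have f₂ : (R.next (R.next d)).fst = d.fst := by simp
  have f₃ : (R.next (R.next (R.next d))).fst = d.fst := by simp
  have f₄ : (R.next (R.next (R.next (R.next d)))).fst = d.fst := by simp
  generalize R.next (R.next (R.next (R.next d))) = d₄ at *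
  generalize R.next (R.next (R.next d)) = d₃ at *
  generalize R.next (R.next d) = d₂ at *
  generalize R.next d = d₁ at *
  have hdeg : ∀ e : G.Dart, e.fst = d.fst → e.snd ≠ d.snd → G.degree e.symm.fst = 3 :=
    fun e he hne => hn.degree_eq_three d.adj (by omega) (he ▸ e.adj) hne
  have key : ∀ e : G.Dart, e.fst = d.fst → e.snd ≠ d.snd →
      (∀ z, G.Adj e.snd z ↔ z = d.fst ∨ z = (R.next e.symm).snd ∨ z = (R.next.symm e.symm).snd) ∧
      [d.fst, (R.next e.symm).snd, (R.next.symm e.symm).snd].Nodup := fun e he hne => by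
    have h1 := R.adj_iff_of_degree_eq_three (hdeg e he hne)
    have h2 := R.nodup_of_degree_eq_three (hdeg e he hne)
    rw [← he]
    exact ⟨h1, h2⟩
  have g₁ : d₁.snd ≠ d.snd := fun h => by simp [h] at hu
  have g₂ : d₂.snd ≠ d.snd := fun h => by simp [h] at hu
  have g₃ : d₃.snd ≠ d.snd := fun h => by simp [h] at hu
  have g₄ : d₄.snd ≠ d.snd := fun h => by simp [h] at hu
  obtain ⟨n₁, m₁⟩ := key d₁ f₁ g₁
  obtain ⟨n₂, m₂⟩ := key d₂ f₂ g₂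
  obtain ⟨n₃, m₃⟩ := key d₃ f₃ g₃
  obtain ⟨n₄, m₄⟩ := key d₄ f₄ g₄
  rw [e₁] at n₁ m₁
  rw [e₂] at n₂ m₂
  rw [e₃] at n₃ m₃
  rw [e₄, ← e₅] at n₄ m₄
  set x₄ := (R.next d.symm).snd
  set x₀ := (R.next.symm d.symm).snd
  -- The 4-vertex `d.snd` shares quadrilaterals with `d₄.snd` and `d₁.snd`, so it sees both end
  -- vertices `x₄` and `x₀`; `b` is its remaining neighbour. It can thus close the chain in either
  -- direction.
  obtain ⟨b, hv⟩ : ∃ b, ∀ z, G.Adj d.snd z ↔ z = d.fst ∨ z = x₄ ∨ z = x₀ ∨ z = b := by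
    refine ⟨(R.next (R.next d.symm)).snd, fun z => ?_⟩
    have hp := R.next_pow_degree d.symm
    have hd : G.degree d.symm.fst = 4 := h4
    rw [hd] at hp
    have hx₀ : x₀ = ((R.next ^ 3) d.symm).snd := by
      rw [← show R.next.symm d.symm = (R.next ^ 3) d.symm from R.next.symm_apply_eq.2 hp.symm]
    constructor
    · intro hz
      obtain ⟨n, hn, rfl⟩ := R.exists_next_pow_snd_eq d.symm hz
      rw [hd] at hn
      interval_cases n
      · exact Or.inl rfl
      · exact Or.inr (Or.inl rfl)
      · exact Or.inr (Or.inr (Or.inr rfl))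
      · exact Or.inr (Or.inr (Or.inl hx₀.symm))
    · rintro (rfl | rfl | rfl | rfl)
      · exact d.adj.symm
      · exact R.adj_next_pow d.symm 1
      · rw [hx₀]; exact R.adj_next_pow d.symm 3
      · exact R.adj_next_pow d.symm 2
  have c₁ := not_isChain_of_lt_bondage hb htri (hdeg d₁ f₁ g₁) (hdeg d₃ f₃ g₃)
    (u₁ := d₁.snd) (u₂ := d₂.snd) (u₃ := d₃.snd) (u₄ := d₄.snd) (v := d.snd)
    (fun z => (hw z).trans or_five_rotate)
    ((List.perm_append_comm (l₁ := [d.snd]) (l₂ := [d₁.snd, d₂.snd, d₃.snd, d₄.snd])).nodup_iff.1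
      hu) n₁ m₁ n₂ m₂ n₃ m₃ n₄ m₄ (b := x₀)
    (fun z hz => (hv z).1 hz) ((hv _).2 (by simp))
  have c₂ := not_isChain_of_lt_bondage hb htri (hdeg d₄ f₄ g₄) (hdeg d₂ f₂ g₂)
    (u₁ := d₄.snd) (u₂ := d₃.snd) (u₃ := d₂.snd) (u₄ := d₁.snd) (v := d.snd)
    (fun z => (hw z).trans or_five_reverse)
    ((List.reverse_perm _).nodup_iff.2 hu)
    (fun z => (n₄ z).trans or_three_swap) (nodup_three_swap m₄)
    (fun z => (n₃ z).trans or_three_swap) (nodup_three_swap m₃)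
    (fun z => (n₂ z).trans or_three_swap) (nodup_three_swap m₂)
    (fun z => (n₁ z).trans or_three_swap) (nodup_three_swap m₁) (b := x₄)
    (fun z hz => ((hv z).1 hz).imp_right or_left_comm.1) ((hv _).2 (by simp))
  -- Again `x₄ ≠ x₂` from one direction meets `x₄ = x₂` from the other.
  exact c₁.2.2 c₂.1

end RotationSystem

end SimpleGraph

/-! ### Needy vertices around a 5-vertex -/

namespace SimpleGraph

variable {V : Type*} {G : SimpleGraph V} [Fintype V] [DecidableRel G.Adj]

namespace RotationSystem

variable {R : RotationSystem G}

/-- Seen from the corner of the quadrilateral opposite to `d.fst`, the two neighbours on the face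
are consecutive too, with their order exchanged. This controls the rotation at the outer vertices of
a star. -/
theorem next_snd_of_faceLength_eq_four {d e : G.Dart} (h : R.faceLength (R.next d) = 4)
    (h₁ : e.fst = (R.next.symm d.symm).snd) (h₂ : e.snd = (R.next d).snd) :
    (R.next e).snd = d.snd := by
  have he : e = (R.next (R.next d).symm).symm :=
    Dart.eq_of_fst_snd (h₁.trans (R.next_symm_snd_of_faceLength_eq_four h).symm)
      (h₂.trans (R.next_fst (R.next d).symm).symm)
  rw [he, R.next_symm_of_faceLength_eq_four h]
  exact R.next_symm_fst d.symm

/-- The neighborhoods around a needy vertex `d.fst` whose neighbor `d.snd` does not have degree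
three: the darts at it are `d`, `d₁`, `d₂`, `d₃`, `d₄`. -/
structure NeedyStar (R : RotationSystem G) (d d₁ d₂ d₃ d₄ : G.Dart) (a f x : V) : Prop where
  next₀ : R.next d = d₁
  next₁ : R.next d₁ = d₂
  next₂ : R.next d₂ = d₃
  next₃ : R.next d₃ = d₄
  next₄ : R.next d₄ = d
  adj_iff : ∀ z, G.Adj d.fst z ↔ z = d.snd ∨ z = d₁.snd ∨ z = d₂.snd ∨ z = d₃.snd ∨ z = d₄.snd
  nodup : [d.snd, d₁.snd, d₂.snd, d₃.snd, d₄.snd].Nodup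
  adj_iff₁ : ∀ z, G.Adj d₁.snd z ↔ z = d.fst ∨ z = (R.next.symm d.symm).snd ∨ z = a
  nodup₁ : [d.fst, (R.next.symm d.symm).snd, a].Nodup
  adj_iff₂ : ∀ z, G.Adj d₂.snd z ↔ z = d.fst ∨ z = a ∨ z = f
  nodup₂ : [d.fst, a, f].Nodup
  adj_iff₃ : ∀ z, G.Adj d₃.snd z ↔ z = d.fst ∨ z = f ∨ z = x
  nodup₃ : [d.fst, f, x].Nodup
  adj_iff₄ : ∀ z, G.Adj d₄.snd z ↔ z = d.fst ∨ z = x ∨ z = (R.next d.symm).snd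
  nodup₄ : [d.fst, x, (R.next d.symm).snd].Nodup
  degree₁ : G.degree d₁.snd = 3
  degree₂ : G.degree d₂.snd = 3
  degree₃ : G.degree d₃.snd = 3
  degree₄ : G.degree d₄.snd = 3
  turn₁ : ∀ e : G.Dart, e.fst = a → e.snd = d₂.snd → (R.next e).snd = d₁.snd
  turn₂ : ∀ e : G.Dart, e.fst = f → e.snd = d₃.snd → (R.next e).snd = d₂.snd
  turn₃ : ∀ e : G.Dart, e.fst = x → e.snd = d₄.snd → (R.next e).snd = d₃.snd
  next_left : R.next (R.next d.symm).symm = (R.next.symm d₄.symm).symm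
  eq₁ : (R.next.symm d₁.symm).snd = a
  eq₄ : (R.next d₄.symm).snd = x

theorem IsNeedy.exists_needyStar {d : G.Dart} (hn : R.IsNeedy d.fst) (hd : G.degree d.snd ≠ 3) :
    ∃ d₁ d₂ d₃ d₄ a f x, R.NeedyStar d d₁ d₂ d₃ d₄ a f x := by
  have h5 := hn.1
  have hL := hn.2.2
  have hw := R.adj_iff_of_degree_eq_five h5
  have hu := R.nodup_of_degree_eq_five h5
  have h5' := R.next_symm_eq_of_degree_eq_five h5
  rw [h5'] at hu hw
  have h5'' := R.next.symm_apply_eq.1 h5'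
  have l₀ := hL d rfl
  have l₁ := hL (R.next d) (by simp)
  have l₂ := hL (R.next (R.next d)) (by simp)
  have l₃ := hL (R.next (R.next (R.next d))) (by simp)
  have l₄ := hL (R.next (R.next (R.next (R.next d)))) (by simp)
  have l₅ : R.faceLength (R.next (R.next (R.next (R.next (R.next d))))) = 4 := by
    rw [← h5'']; exact l₀
  have e₁ := R.next_symm_snd_of_faceLength_eq_four l₁
  have e₂ := R.next_symm_snd_of_faceLength_eq_four l₂
  have e₃ := R.next_symm_snd_of_faceLength_eq_four l₃
  have e₄ := R.next_symm_snd_of_faceLength_eq_four l₄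
  have e₅ := R.next_symm_snd_of_faceLength_eq_four l₅
  have t₂ := fun e => R.next_snd_of_faceLength_eq_four (e := e) l₂
  have t₃ := fun e => R.next_snd_of_faceLength_eq_four (e := e) l₃
  have t₄ := fun e => R.next_snd_of_faceLength_eq_four (e := e) l₄
  have s₅ := R.next_symm_of_faceLength_eq_four l₅
  rw [← h5''] at e₅ s₅
  have f₁ : (R.next d).fst = d.fst := by simp
  have f₂ : (R.next (R.next d)).fst = d.fst := by simp
  have f₃ : (R.next (R.next (R.next d))).fst = d.fst := by simp
  have f₄ : (R.next (R.next (R.next (R.next d)))).fst = d.fst := by simp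
  obtain ⟨d₁, hd₁⟩ : ∃ d₁, R.next d = d₁ := ⟨_, rfl⟩
  obtain ⟨d₂, hd₂⟩ : ∃ d₂, R.next d₁ = d₂ := ⟨_, rfl⟩
  obtain ⟨d₃, hd₃⟩ : ∃ d₃, R.next d₂ = d₃ := ⟨_, rfl⟩
  obtain ⟨d₄, hd₄⟩ : ∃ d₄, R.next d₃ = d₄ := ⟨_, rfl⟩
  simp only [hd₁, hd₂, hd₃, hd₄] at h5'' hw hu e₁ e₂ e₃ e₄ e₅ t₂ t₃ t₄ s₅ f₁ f₂ f₃ f₄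
  have hdeg : ∀ e : G.Dart, e.fst = d.fst → e.snd ≠ d.snd → G.degree e.snd = 3 :=
    fun e he hne => hn.degree_eq_three d.adj hd (he ▸ e.adj) hne
  have key : ∀ e : G.Dart, e.fst = d.fst → e.snd ≠ d.snd →
      (∀ z, G.Adj e.snd z ↔ z = d.fst ∨ z = (R.next e.symm).snd ∨ z = (R.next.symm e.symm).snd) ∧
      [d.fst, (R.next e.symm).snd, (R.next.symm e.symm).snd].Nodup := fun e he hne => by
    have h1 := R.adj_iff_of_degree_eq_three (d := e.symm) (hdeg e he hne)
    have h2 := R.nodup_of_degree_eq_three (d := e.symm) (hdeg e he hne)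
    rw [← he]
    exact ⟨h1, h2⟩
  have g₁ : d₁.snd ≠ d.snd := fun h => by simp [h] at hu
  have g₂ : d₂.snd ≠ d.snd := fun h => by simp [h] at hu
  have g₃ : d₃.snd ≠ d.snd := fun h => by simp [h] at hu
  have g₄ : d₄.snd ≠ d.snd := fun h => by simp [h] at hu
  obtain ⟨n₁, m₁⟩ := key d₁ f₁ g₁
  obtain ⟨n₂, m₂⟩ := key d₂ f₂ g₂
  obtain ⟨n₃, m₃⟩ := key d₃ f₃ g₃
  obtain ⟨n₄, m₄⟩ := key d₄ f₄ g₄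
  rw [e₁] at n₁ m₁
  rw [e₂] at n₂ m₂
  rw [e₃] at n₃ m₃
  rw [e₄, ← e₅] at n₄ m₄
  exact ⟨d₁, d₂, d₃, d₄, _, _, _, hd₁, hd₂, hd₃, hd₄, h5''.symm, hw, hu, n₁, m₁, n₂, m₂, n₃, m₃,
    n₄, m₄, hdeg d₁ f₁ g₁, hdeg d₂ f₂ g₂, hdeg d₃ f₃ g₃, hdeg d₄ f₄ g₄, t₂, t₃, t₄, s₅, rfl, e₄⟩

/-- The neighbors of a vertex of degree five on both sides of a needy neighbor do not have degree
three. -/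
theorem IsNeedy.degree_next_snd_ne (hb : 6 < G.independentBondageNumber) {g : G.Dart}
    (hn : R.IsNeedy g.snd) (h5 : G.degree g.fst = 5) :
    G.degree (R.next g).snd ≠ 3 ∧ G.degree (R.next.symm g).snd ≠ 3 := by
  obtain ⟨d₁, d₂, d₃, d₄, a, f, x, S⟩ := IsNeedy.exists_needyStar (d := g.symm) hn
    (by change G.degree g.fst ≠ 3; omega)
  have h₁ := lt_degree_add_degree_of_adj hb ((S.adj_iff₁ _).2 (Or.inr (Or.inl rfl)))
  have h₄ := lt_degree_add_degree_of_adj hb ((S.adj_iff₄ _).2 (Or.inr (Or.inr rfl)))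
  rw [S.degree₁, Dart.symm_symm] at h₁
  rw [S.degree₄, Dart.symm_symm] at h₄
  omega

/-- Two needy vertices are not consecutive around a vertex of degree five. -/
theorem not_isNeedy_next (hb : 6 < G.independentBondageNumber) (hdeg : ∀ v, 3 ≤ G.degree v) {g :
    G.Dart}
    (h5 : G.degree g.fst = 5) (hn : R.IsNeedy g.snd) : ¬ R.IsNeedy (R.next g).snd := by
  intro hn'
  have hy := R.adj_iff_of_degree_eq_five h5
  have dy := R.nodup_of_degree_eq_five h5
  obtain ⟨d₁, d₂, d₃, d₄, a, f, x, S⟩ := IsNeedy.exists_needyStar (d := g.symm) hn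
    (by change G.degree g.fst ≠ 3; omega)
  obtain ⟨b₁, b₂, b₃, b₄, x₀, f', x', S'⟩ := IsNeedy.exists_needyStar (d := (R.next g).symm) hn'
    (by change G.degree (R.next g).fst ≠ 3; rw [next_fst]; omega)
  -- The corner at `g.fst` between the two needy vertices lies in a quadrilateral. Its fourth vertex
  -- is the last 3-neighbour of the first star and the first of the second, and its third neighbour
  -- serves both stars, so `x₀ = x`.
  have hb₁ : b₁ = (R.next.symm d₄.symm).symm := by
    rw [← S'.next₀, ← S.next_left, Dart.symm_symm]
  have hs : b₁.snd = d₄.snd := by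
    rw [hb₁]; exact R.next_symm_fst d₄.symm
  have hx : x₀ = x := by
    have hd : G.degree d₄.symm.fst = 3 := S.degree₄
    rw [← S'.eq₁, ← S.eq₄, hb₁, Dart.symm_symm, R.next_symm_eq_of_degree hd,
      R.next.symm_apply_apply]
  subst hx
  obtain ⟨-, -, -, -, -, hw, dw, ht, dt, hp, dp, hq, dq, hs', ds, dt3, dp3, dq3, ds3, T₁, T₂, T₃,
      S₈,
    -, -⟩ := S
  obtain ⟨-, N₁, N₂, N₃, N₄, hw', dw', -, -, hp', dp', hq', dq', ht', dt', -, dp3', -, -, T₁', -,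
    -, -, -, -⟩ := S'
  rw [hs] at hw' dw' T₁'
  simp only [Dart.symm_symm] at *
  have hv₂ : b₂.fst = (R.next g).snd := by rw [← N₁, next_fst, hb₁, ← S₈, next_fst]; rfl
  have hv₃ : b₃.fst = (R.next g).snd := by rw [← N₂, next_fst, hv₂]
  have hv₄ : b₄.fst = (R.next g).snd := by rw [← N₃, next_fst, hv₃]
  have e5 : (R.next g).symm.snd = g.fst := R.next_fst g
  have e5' : (R.next g).symm.fst = (R.next g).snd := rfl
  have e0 : g.symm.fst = g.snd := rfl
  have e0' : g.symm.snd = g.fst := rfl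
  rw [e5] at hw' dw'
  rw [e5'] at hw' hp' hq' ht' dp' dq' dt'
  rw [e0'] at hw dw
  rw [e0] at hw ht hp hq hs' dt dp dq ds
  have k₂ : (R.next b₂).snd = b₃.snd := by rw [N₂]
  have k₃ : (R.next b₃).snd = b₄.snd := by rw [N₃]
  have k₄ : (R.next b₄).snd = g.fst := by rw [N₄, e5]
  generalize (R.next.symm g).snd = n₄ at *
  generalize (R.next (R.next (R.next g))).snd = n₃ at *
  generalize (R.next (R.next g)).snd = n₂ at *
  generalize (R.next g).snd = w' at *
  -- If `q = p'`, two steps of the rotation at `x₀` would lead from `s` back to `s`, impossible at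
  -- degree at least 3.
  have hxx : ∀ e : G.Dart, e.fst = x₀ → e.snd = d₄.snd → d₃.snd ≠ b₂.snd := by
    intro e h1 h2 h3
    have h4 := T₃ e h1 h2
    have h5 := T₁' (R.next e) (by rw [next_fst, h1]) (h4.trans h3)
    exact R.next_next_snd_ne (hdeg _) (h5.trans h2.symm)
  have hxs : d₃.snd ≠ b₂.snd :=
    hxx ⟨(x₀, d₄.snd), ((hs' _).2 (by simp)).symm⟩ rfl rfl
  have hty : d₁.snd ≠ g.fst := fun h => by rw [h] at dt3; omega
  have hpy : d₂.snd ≠ g.fst := fun h => by rw [h] at dp3; omega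
  have hqy : d₃.snd ≠ g.fst := fun h => by rw [h] at dq3; omega
  simp only [List.nodup_cons, List.mem_cons, List.not_mem_nil, or_false, not_or, not_false_eq_true,
    List.nodup_nil, and_true] at dy dw dt dp dq ds dp' dq' dt'
  -- If `a = w'`, then `p` is a neighbour of `w'` too, and its successor around `w'` must be `t`.
  -- Comparison with the rotation of the second star identifies `t` with a vertex of the wrong
  -- degree or neighbourhood. The case `f = w'` below is analogous.
  have ha : a ≠ w' := by
    rintro rfl
    have hadj := (hw' d₂.snd).1 ((hp _).2 (by simp)).symm
    have h₂ := T₁ b₂ hv₂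
    have h₃ := T₁ b₃ hv₃
    have h₄ := T₁ b₄ hv₄
    rw [k₂] at h₂
    rw [k₃] at h₃
    rw [k₄] at h₄
    have i₁ := hp g.snd
    have i₂ := hp f
    have i₃ := hp' g.snd
    have i₄ := hp' f
    have i₅ := ht g.snd
    have i₆ := ht n₄
    have i₇ := ht' g.snd
    have i₈ := ht' n₄
    clear hy hw hw' ht hp hq hs' hp' hq' ht' T₁ T₂ T₃ T₁' hxx hdeg
    grind
  have hf : f ≠ w' := by
    rintro rfl
    have hadj := (hw' d₃.snd).1 ((hq _).2 (by simp)).symm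
    have h₃ := T₂ b₃ hv₃
    have h₄ := T₂ b₄ hv₄
    rw [k₃] at h₃
    rw [k₄] at h₄
    have i₁ := hp g.snd
    have i₂ := ht' g.snd
    have i₃ := hq x₀
    have i₄ := hq' x₀
    clear hy hw hw' ht hp hq hs' hp' hq' ht' T₁ T₂ T₃ T₁' hxx hdeg
    grind
  have hne : d₂.snd ≠ b₂.snd := by
    intro h
    have := (hp w').1 (h ▸ (hp' w').2 (by simp))
    grind
  obtain ⟨D, hD⟩ := exists_isRedundantPair hb hne
    (fun h => by have := lt_degree_add_degree_of_adj hb h; omega) dp3 dp3'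
  refine hD.false_of_adjacent_stars hy hw ?_ hw' ?_ ht ?_ hp ?_ hq ?_ hs' ?_ hp' ?_ hq' ?_ ht' ?_
    ?_ ha hf
  all_goals
    clear hy hw hw' ht hp hq hs' hp' hq' ht' T₁ T₂ T₃ T₁' hxx hdeg
    try simp only [List.nodup_cons, List.mem_cons, List.not_mem_nil, or_false, not_or,
      not_false_eq_true, List.nodup_nil, and_true]
    first | assumption | grind

end RotationSystem

end SimpleGraph

/-! ### Discharging: faces can pay the poor vertices -/

namespace SimpleGraph

variable {V : Type*} {G : SimpleGraph V} [Fintype V] [DecidableRel G.Adj]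

/-- Five cyclic positions with no three consecutive ones marked have at most three marked. -/
theorem ite_cyclic_le_one (p q r s t : Prop) [Decidable p] [Decidable q] [Decidable r]
    [Decidable s] [Decidable t] (h₁ : p → q → ¬ r) (h₂ : q → r → ¬ s) (h₃ : r → s → ¬ t)
    (h₄ : s → t → ¬ p) (h₅ : t → p → ¬ q) :
    (if p then (1 / 3 : ℚ) else 0) + (if q then 1 / 3 else 0) + (if r then 1 / 3 else 0) +
      (if s then 1 / 3 else 0) + (if t then 1 / 3 else 0) ≤ 1 := by
  split_ifs <;> first | (norm_num; done) | (exfalso; tauto)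

/-- The vertex `v` has degree five and at least four neighbors of degree three. -/
def IsPoor (G : SimpleGraph V) [DecidableRel G.Adj] (v : V) : Prop :=
  G.degree v = 5 ∧ ∀ u z, G.Adj v u → G.Adj v z → G.degree u ≠ 3 → G.degree z ≠ 3 → u = z

namespace RotationSystem

variable (R : RotationSystem G)

open Classical in
/-- The charge sent along `d` from its face to its source. -/
noncomputable def faceCharge (d : G.Dart) : ℚ :=
  if G.IsPoor d.fst ∧ 5 ≤ R.faceLength d then 1 / 3 else 0

open Classical in
/-- The charge sent from `v` to its neighbor `u`. -/
noncomputable def vertexCharge (v u : V) : ℚ :=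
  if G.degree u = 3 ∨ R.IsNeedy u ∧ G.degree v ≠ 3 then 1 / 3 else 0

theorem faceCharge_nonneg (d : G.Dart) : 0 ≤ R.faceCharge d := by
  unfold faceCharge; split_ifs <;> norm_num

theorem vertexCharge_nonneg (v u : V) : 0 ≤ R.vertexCharge v u := by
  unfold vertexCharge; split_ifs <;> norm_num

theorem vertexCharge_le (v u : V) : R.vertexCharge v u ≤ 1 / 3 := by
  unfold vertexCharge; split_ifs <;> norm_num

/-- The middle vertex would have two distinct neighbours of degree 5, but a poor vertex has at most
one neighbour whose degree is not 3. -/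
theorem not_isPoor_of_isPoor {d : G.Dart} (h : G.IsPoor d.fst) (h₁ : G.IsPoor (R.facePerm d).fst) :
    ¬ G.IsPoor (R.facePerm (R.facePerm d)).fst := by
  intro h₂
  have e₁ : (R.facePerm d).fst = d.snd := R.next_fst d.symm
  have e₂ : (R.facePerm (R.facePerm d)).fst = (R.facePerm d).snd := R.next_fst _
  rw [e₁] at h₁
  rw [e₂] at h₂
  refine R.next_snd_ne (d := d.symm) (by rw [show G.degree d.symm.fst = 5 from h₁.1]; omega)
    (h₁.2 _ _ ?_ d.adj.symm (by have := h₂.1; intro h'; rw [facePerm_apply] at this; omega)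
      (by have := h.1; intro h'; change G.degree d.fst = 3 at h'; omega))
  rw [← e₁]
  exact (R.facePerm d).adj

/-- The inequality can fail for one dart of a pentagon, which holds 1/5 and may pay 1/3. Averaging
over five consecutive darts of the face walk treats all lengths at once: the window is exactly a
pentagon, which has total charge 1 and pays at most three times, while for other lengths every term
is nonnegative. -/
theorem sum_faceCharge_le [Fintype G.Dart] (hL : ∀ d, 4 ≤ R.faceLength d) :
    ∑ d, R.faceCharge d ≤ ∑ d, (1 - 4 / (R.faceLength d : ℚ)) := by
  classical
  obtain ⟨φ, hφ₀⟩ : ∃ φ, φ = R.facePerm := ⟨_, rfl⟩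
  set g : G.Dart → ℚ := fun d => (1 - 4 / (R.faceLength d : ℚ)) - R.faceCharge d with hg
  have hφ : ∀ f : G.Dart → ℚ, ∑ d, f (φ d) = ∑ d, f d := fun f => Equiv.sum_comp φ f
  have hsum : ∑ d, (g d + g (φ d) + g (φ (φ d)) + g (φ (φ (φ d))) + g (φ (φ (φ (φ d))))) =
      5 * ∑ d, g d := by
    simp only [Finset.sum_add_distrib]
    rw [hφ (fun d => g (φ (φ (φ d)))), hφ (fun d => g (φ (φ d))), hφ (fun d => g (φ d)), hφ g]
    ring
  have hfl : ∀ d, R.faceLength (φ d) = R.faceLength d := by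
    rw [hφ₀]; exact R.faceLength_facePerm
  have hpoor : ∀ d : G.Dart, G.IsPoor d.fst → G.IsPoor (φ d).fst → ¬ G.IsPoor (φ (φ d)).fst := by
    rw [hφ₀]; exact fun d => R.not_isPoor_of_isPoor
  have hpos : ∀ d, 0 ≤ g d + g (φ d) + g (φ (φ d)) + g (φ (φ (φ d))) + g (φ (φ (φ (φ d)))) := by
    intro d
    by_cases h5 : R.faceLength d = 5
    · have hcyc : φ (φ (φ (φ (φ d)))) = d := by
        have := R.facePerm_pow_faceLength d
        rw [h5, ← hφ₀] at this
        exact this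
      have n₀ := hpoor (d)
      have n₁ := hpoor (φ d)
      have n₂ := hpoor (φ (φ d))
      have n₃ := hpoor (φ (φ (φ d)))
      have n₄ := hpoor (φ (φ (φ (φ d))))
      rw [hcyc] at n₃ n₄
      have := ite_cyclic_le_one _ _ _ _ _ n₀ n₁ n₂ n₃ n₄
      have hc : ∀ e, R.faceLength e = 5 →
          R.faceCharge e = if G.IsPoor e.fst then 1 / 3 else 0 := fun e he => by
        simp [faceCharge, he]
      simp only [hg]
      rw [hc d h5, hc (φ d) (by simp only [hfl, h5]), hc (φ (φ d)) (by simp only [hfl, h5]),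
        hc (φ (φ (φ d))) (by simp only [hfl, h5]), hc (φ (φ (φ (φ d)))) (by simp only [hfl, h5])]
      simp only [hfl, h5]
      push_cast
      linarith
    · have hnn : ∀ e, R.faceLength e = R.faceLength d → 0 ≤ g e := by
        intro e he
        have h4 := hL d
        simp only [hg, he]
        rcases h4.eq_or_lt with h | h
        · have : R.faceCharge e = 0 := if_neg fun h' => by omega
          rw [this, ← h]
          norm_num
        · have h6 : (6 : ℚ) ≤ R.faceLength d := by
            have : 6 ≤ R.faceLength d := by omega
            exact_mod_cast this
          have h1 : R.faceCharge e ≤ 1 / 3 := by unfold faceCharge; split_ifs <;> norm_num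
          have h2 : 4 / (R.faceLength d : ℚ) ≤ 2 / 3 := by
            rw [div_le_iff₀ (by linarith)]
            linarith
          linarith
      have := hnn d rfl
      have := hnn (φ d) (by simp only [hfl])
      have := hnn (φ (φ d)) (by simp only [hfl])
      have := hnn (φ (φ (φ d))) (by simp only [hfl])
      have := hnn (φ (φ (φ (φ d)))) (by simp only [hfl])
      linarith
  have h0 : 0 ≤ ∑ d, g d := by
    have := Finset.sum_nonneg fun d (_ : d ∈ Finset.univ) => hpos d
    rw [hsum] at this
    linarith
  simp only [hg, Finset.sum_sub_distrib] at h0 ⊢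
  linarith

end RotationSystem

end SimpleGraph

/-! ### Discharging: vertices, and the contradiction -/

namespace SimpleGraph

variable {V : Type*} {G : SimpleGraph V} [Fintype V] [DecidableRel G.Adj]

namespace RotationSystem

variable {R : RotationSystem G}

theorem sum_vertexCharge_le (v : V) :
    ∑ u ∈ G.neighborFinset v, R.vertexCharge v u ≤ G.degree v / 3 := by
  refine (Finset.sum_le_card_nsmul _ _ (1 / 3) fun u _ => R.vertexCharge_le v u).trans ?_
  rw [card_neighborFinset_eq_degree, nsmul_eq_mul]
  linarith

theorem sum_vertexCharge_le_of_eq_zero {v a b : V} (h5 : G.degree v = 5) (ha : G.Adj v a)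
    (hb : G.Adj v b) (hab : a ≠ b) (ha0 : R.vertexCharge v a = 0) (hb0 : R.vertexCharge v b = 0) :
    ∑ u ∈ G.neighborFinset v, R.vertexCharge v u ≤ 1 := by
  classical
  have hA : a ∈ G.neighborFinset v := (G.mem_neighborFinset v a).2 ha
  have hB : b ∈ (G.neighborFinset v).erase a :=
    Finset.mem_erase.2 ⟨hab.symm, (G.mem_neighborFinset v b).2 hb⟩
  rw [← Finset.add_sum_erase _ _ hA, ← Finset.add_sum_erase _ _ hB, ha0, hb0]
  have h := Finset.sum_le_card_nsmul (((G.neighborFinset v).erase a).erase b)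
    (fun u => R.vertexCharge v u) (1 / 3) fun u _ => R.vertexCharge_le v u
  rw [Finset.card_erase_of_mem hB, Finset.card_erase_of_mem hA, card_neighborFinset_eq_degree,
    h5, nsmul_eq_mul] at h
  norm_num at h ⊢
  exact h

theorem sum_vertexCharge_eq [DecidableEq V] {v : V} (h : ∀ u, G.Adj v u → ¬ R.IsNeedy u) :
    ∑ u ∈ G.neighborFinset v, R.vertexCharge v u =
      ((G.neighborFinset v).filter fun u => G.degree u = 3).card / 3 := by
  classical
  rw [Finset.sum_congr rfl (g := fun u => if G.degree u = 3 then (1 / 3 : ℚ) else 0),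
    ← Finset.sum_filter, Finset.sum_const, nsmul_eq_mul]
  · ring
  · intro u hu
    have := h u ((G.mem_neighborFinset v u).1 hu)
    simp [vertexCharge, this]

/-- After the charges have been sent, no vertex is left with a negative charge. -/
theorem vertex_charge_nonneg [Fintype G.Dart] [DecidableEq V]
    (hb : 6 < G.independentBondageNumber) (hdeg : ∀ v, 3 ≤ G.degree v)
    (htri : ∀ a b c, G.Adj a b → G.Adj b c → ¬ G.Adj a c) (hL : ∀ d, 4 ≤ R.faceLength d) (v : V) :
    0 ≤ (G.degree v - 4 : ℚ) - ∑ u ∈ G.neighborFinset v, R.vertexCharge v u +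
      ∑ u ∈ G.neighborFinset v, R.vertexCharge u v + ∑ d : G.Dart with d.fst = v, R.faceCharge d :=
          by
  classical
  have hin : 0 ≤ ∑ u ∈ G.neighborFinset v, R.vertexCharge u v :=
    Finset.sum_nonneg fun u _ => R.vertexCharge_nonneg u v
  have hface : 0 ≤ ∑ d : G.Dart with d.fst = v, R.faceCharge d :=
    Finset.sum_nonneg fun d _ => R.faceCharge_nonneg d
  have hout := sum_vertexCharge_le (R := R) v
  have hcases : G.degree v = 3 ∨ G.degree v = 4 ∨ G.degree v = 5 ∨ 6 ≤ G.degree v := by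
    have := hdeg v
    omega
  rcases hcases with h | h | h | h
  · have h₁ : ∑ u ∈ G.neighborFinset v, R.vertexCharge v u = 0 := by
      refine Finset.sum_eq_zero fun u hu => if_neg ?_
      have := lt_degree_add_degree_of_adj hb ((G.mem_neighborFinset v u).1 hu)
      rintro (h' | ⟨-, h'⟩)
      · omega
      · exact h' h
    have h₂ : ∑ u ∈ G.neighborFinset v, R.vertexCharge u v = 1 := by
      rw [Finset.sum_congr rfl (g := fun _ => (1 / 3 : ℚ)) fun u _ =>
        show R.vertexCharge u v = 1 / 3 from if_pos (Or.inl h), Finset.sum_const,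
            card_neighborFinset_eq_degree, h]
      norm_num
    rw [h₁, h₂, h]
    norm_num
    exact hface
  · have h₁ : ∑ u ∈ G.neighborFinset v, R.vertexCharge v u = 0 := by
      refine Finset.sum_eq_zero fun u hu => if_neg ?_
      have hvu := (G.mem_neighborFinset v u).1 hu
      have := lt_degree_add_degree_of_adj hb hvu
      rintro (h' | ⟨h', -⟩)
      · omega
      · exact R.not_isNeedy_of_degree_eq_four hb htri (d := ⟨(u, v), hvu.symm⟩) h h'
    rw [h₁, h]
    norm_num
    linarith
  -- A 5-vertex starts with charge 1 and can pay three times. With a needy neighbour, both vertices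
  -- next to it in the rotation have degree different from 3 and are not needy, so at most three
  -- neighbours are paid.
  · by_cases hn : ∃ u, G.Adj v u ∧ R.IsNeedy u
    · obtain ⟨u, hvu, hu⟩ := hn
      let g : G.Dart := ⟨(v, u), hvu⟩
      have hg5 : G.degree g.fst = 5 := h
      have hd := IsNeedy.degree_next_snd_ne hb (g := g) hu h
      have hn₁ := R.not_isNeedy_next hb hdeg hg5 hu
      have hn₂ : ¬ R.IsNeedy (R.next.symm g).snd := fun h' => by
        have := R.not_isNeedy_next hb hdeg (g := R.next.symm g)
          (by rw [next_symm_fst]; exact hg5) h'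
        rw [Equiv.apply_symm_apply] at this
        exact this hu
      have ha := (R.next g).adj
      have hb' := (R.next.symm g).adj
      rw [next_fst] at ha
      rw [next_symm_fst] at hb'
      have hab : (R.next g).snd ≠ (R.next.symm g).snd := by
        have := R.nodup_of_degree_eq_five hg5
        intro h'
        simp [h'] at this
      have := sum_vertexCharge_le_of_eq_zero (R := R) h ha hb' hab
        (if_neg (by tauto)) (if_neg (by tauto))
      rw [h]
      norm_num
      linarith
    · push Not at hn
      rw [sum_vertexCharge_eq hn, h]
      set T := (G.neighborFinset v).filter fun u => G.degree u = 3 with hT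
      set T' := (G.neighborFinset v).filter fun u => ¬ G.degree u = 3 with hT'
      have hcard : T.card + T'.card = 5 := by
        rw [hT, hT', Finset.card_filter_add_card_filter_not, card_neighborFinset_eq_degree, h]
      by_cases h3 : T.card ≤ 3
      · have : (T.card : ℚ) ≤ 3 := by exact_mod_cast h3
        norm_num
        linarith
      have hT1 : T'.card ≤ 1 := by omega
      have hpoor : G.IsPoor v := by
        refine ⟨h, fun u z hu hz hu3 hz3 => Finset.card_le_one.1 hT1 u ?_ z ?_⟩
        · simp [hT', hu, hu3]
        · simp [hT', hz, hz3]
      set S := (Finset.univ.filter fun d : G.Dart => d.fst = v).filter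
        fun d => 5 ≤ R.faceLength d with hS
      have hSsum : (S.card : ℚ) / 3 ≤ ∑ d : G.Dart with d.fst = v, R.faceCharge d := by
        refine le_of_eq_of_le ?_ (Finset.sum_le_sum_of_subset_of_nonneg
          (Finset.filter_subset (fun d => 5 ≤ R.faceLength d) _)
          fun d _ _ => R.faceCharge_nonneg d)
        rw [Finset.sum_congr rfl (g := fun _ => (1 / 3 : ℚ)), Finset.sum_const, nsmul_eq_mul]
        · ring
        · intro d hd
          simp only [Finset.mem_filter, Finset.mem_univ, true_and] at hd
          exact if_pos ⟨hd.1 ▸ hpoor, hd.2⟩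
      have hL4 : ∀ d : G.Dart, d.fst = v → d ∉ S → R.faceLength d = 4 := fun d hd hdS => by
        simp only [hS, Finset.mem_filter, Finset.mem_univ, true_and, hd] at hdS
        have := hL d
        omega
      by_cases h0 : T'.card = 0
      · have hall : ∀ z, G.Adj v z → G.degree z = 3 := fun z hz => by
          by_contra hz3
          exact Finset.notMem_empty z (Finset.card_eq_zero.1 h0 ▸ by simp [hT', hz, hz3])
        -- Five payments exceed the charge by 2/3, hence two long corners are required. With at most
        -- one, start the rotation there (or anywhere): the other four corners are quadrilaterals.
        have hS2 : 2 ≤ S.card := by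
          by_contra! hlt
          obtain ⟨d, hd, hdS⟩ : ∃ d : G.Dart, d.fst = v ∧ ∀ e ∈ S, e = d := by
            rcases S.eq_empty_or_nonempty with he | ⟨d, hd⟩
            · obtain ⟨u, hu⟩ := (G.degree_pos_iff_exists_adj v).1 (by omega)
              exact ⟨⟨(v, u), hu⟩, rfl, by simp [he]⟩
            · refine ⟨d, ?_, fun e he => Finset.card_le_one.1 (by omega) e he d hd⟩
              simp only [hS, Finset.mem_filter, Finset.mem_univ, true_and] at hd
              exact hd.1
          have hl : ∀ n, 0 < n → n < 5 → R.faceLength ((R.next ^ n) d) = 4 := fun n h0 h5 =>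
            hL4 _ ((R.next_pow_fst d n).trans hd) fun hmem =>
              R.next_pow_ne (d := d) (m := n) (n := 0) (by rw [hd]; omega) (by rw [hd]; omega)
                (by omega) (hdS _ hmem)
          exact R.false_of_four_corners hb htri (d := d) (by rw [hd]; exact h)
            (by rw [hd]; exact hall) (hl 1 (by omega) (by omega)) (hl 2 (by omega) (by omega))
            (hl 3 (by omega) (by omega)) (hl 4 (by omega) (by omega))
        have h1 : (2 : ℚ) ≤ S.card := by exact_mod_cast hS2
        have h2 : (T.card : ℚ) = 5 := by
          have : T.card = 5 := by omega
          exact_mod_cast this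
        rw [h2]
        norm_num
        linarith
      · have h2 : (T.card : ℚ) = 4 := by
          have : T.card = 4 := by omega
          exact_mod_cast this
        rw [h2]
        -- Four payments exceed the charge by 1/3. Without a long corner the vertex is needy and the
        -- missing 1/3 comes from its neighbour of degree other than 3; otherwise one long corner
        -- suffices.
        rcases S.eq_empty_or_nonempty with he | hne
        · obtain ⟨u, hu⟩ := Finset.card_pos.1 (Nat.pos_of_ne_zero h0)
          simp only [hT', Finset.mem_filter, mem_neighborFinset] at hu
          have hneedy : R.IsNeedy v := by
            refine ⟨h, ⟨u, hu.1, hu.2, fun z hz hzu => ?_⟩, fun d hd => hL4 d hd (by simp [he])⟩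
            by_contra hz3
            exact hzu (hpoor.2 z u hz hu.1 hz3 hu.2)
          have h3 : R.vertexCharge u v = 1 / 3 := if_pos (Or.inr ⟨hneedy, hu.2⟩)
          have h4 := Finset.single_le_sum (f := fun u => R.vertexCharge u v)
            (fun u _ => R.vertexCharge_nonneg u v) ((G.mem_neighborFinset v u).2 hu.1)
          simp only [h3] at h4
          norm_num at h4 ⊢
          linarith
        · have h1 : (1 : ℚ) ≤ S.card := by exact_mod_cast hne.card_pos
          norm_num
          linarith
  -- From degree 6 on, `deg - 4 ≥ deg / 3`.
  · have h6 : (6 : ℚ) ≤ G.degree v := by exact_mod_cast h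
    linarith

theorem independentBondageNumber_le_of_isSpherical (hR : R.IsSpherical) (hconn : G.Connected)
    (hdeg : ∀ v, 3 ≤ G.degree v) (htri : ∀ a b c, G.Adj a b → G.Adj b c → ¬ G.Adj a c) :
    G.independentBondageNumber ≤ 6 := by
  classical
  by_contra! hb
  have hL := R.four_le_faceLength hdeg htri
  have hpos : ∀ v, 0 < G.degree v := fun v => by have := hdeg v; omega
  have hsum := Finset.sum_nonneg fun v (_ : v ∈ Finset.univ) =>
    vertex_charge_nonneg (R := R) hb hdeg htri hL v
  have hface := R.sum_faceCharge_le hL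
  have heuler := R.sum_curvature_eq hR hconn hpos
  have hdeg' : ∑ v, (G.degree v - 4 : ℚ) = ∑ d : G.Dart, (1 - 4 / (G.degree d.fst : ℚ)) := by
    rw [← Finset.sum_fiberwise (s := Finset.univ) (g := fun d : G.Dart => d.fst)]
    refine Finset.sum_congr rfl fun v _ => ?_
    rw [Finset.sum_congr rfl (g := fun _ => 1 - 4 / (G.degree v : ℚ))
      (fun d hd => by rw [(Finset.mem_filter.1 hd).2]), Finset.sum_const, nsmul_eq_mul,
      G.dart_fst_fiber_card_eq_degree]
    have : (G.degree v : ℚ) ≠ 0 := by exact_mod_cast (hpos v).ne'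
    field_simp
  have hcomm : ∑ v, ∑ u ∈ G.neighborFinset v, R.vertexCharge v u =
      ∑ v, ∑ u ∈ G.neighborFinset v, R.vertexCharge u v :=
    Finset.sum_comm' fun v u => by simp [G.adj_comm]
  have hfib : ∑ v, ∑ d : G.Dart with d.fst = v, R.faceCharge d = ∑ d, R.faceCharge d :=
    Finset.sum_fiberwise _ _ _
  simp only [Finset.sum_add_distrib, Finset.sum_sub_distrib] at hsum heuler hface hdeg'
  rw [hcomm, hfib] at hsum
  -- Payments between vertices cancel, and the faces pay no more than they own, so the nonnegative
  -- total would be at most `-8`.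
  linarith

end RotationSystem

end SimpleGraph

theorem mainTheorem2 {V : Type*} [Fintype V] (G : SimpleGraph V) [DecidableRel G.Adj]
    (hconn : G.Connected) (hplanar : G.IsPlanar) (hdeg : 3 ≤ G.minDegree)
    (hgirth : 4 ≤ G.egirth) :
    G.independentBondageNumber ≤ 6 := by
  obtain ⟨R, hR⟩ := hplanar
  exact R.independentBondageNumber_le_of_isSpherical hR hconn
    (fun v => hdeg.trans (G.minDegree_le_degree v)) (SimpleGraph.not_adj_of_four_le_egirth hgirth)
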